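/- Let $V$ be a real vector space of dimension $2$ and $\mathcal{L}\subset V$ a lattice of rank $2$ (a discrete subgroup spanning $V$). An $\mathcal{L}$-polygon is the convex hull of a nonempty finite set of points of $\mathcal{L}$ (segments and single points are allowed). The universal counting function of an $\mathcal{L}$-polygon $P$ is the function $\mathcal{U}_P(\mathcal{L}')=|P\cap\mathcal{L}'|$, defined on the set of all lattices $\mathcal{L}'\subset V$ containing $\mathcal{L}$. Theorem 3. Let $P$ and $Q$ be $\mathcal{L}$-polygons. Then $\mathcal{U}_P=\mathcal{U}_Q$ if and only if the following two conditions are satisfied: (i) $\operatorname{area}(P)=\operatorname{area}(Q)$ (for any translation-invariant area, i.e. Haar measure, on $V$); (ii) there exist $\mathcal{L}$-polygons $X$ and $Y$ such that $P=p+(X+Y)$ and $Q=q+(X-Y)$ for some $p,q\in\mathcal{L}$, where $X+Y=\{x+y: x\in X, y\in Y\}$ and $X-Y=X+(-Y)=\{x-y: x\in X, y\in Y\}$. -/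

import Mathlib

open scoped Pointwise

/-- A lattice in the finite-dimensional real vector space `V`: a discrete subgroup of `V`
that spans `V` over `ℝ` (so its rank is the dimension of `V`). -/
def IsLattice {V : Type*} [NormedAddCommGroup V] [NormedSpace ℝ V]
    (L : Submodule ℤ V) : Prop :=
  ∃ _ : DiscreteTopology L, IsZLattice ℝ L

/-- The set of all lattices of `V` that contain `L₀`. -/
def latticesContaining {V : Type*} [NormedAddCommGroup V] [NormedSpace ℝ V]
    (L₀ : Submodule ℤ V) : Set (Submodule ℤ V) :=
  {L | IsLattice L ∧ L₀ ≤ L}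

/-- `P` is an `L₀`-polytope: the convex hull of a nonempty finite set of points of `L₀`.
In dimension two these are the `L₀`-polygons; segments and single points are included. -/
def IsLatticePolytope {V : Type*} [NormedAddCommGroup V] [NormedSpace ℝ V]
    (L₀ : Submodule ℤ V) (P : Set V) : Prop :=
  ∃ S : Finset V, S.Nonempty ∧ (S : Set V) ⊆ (L₀ : Set V) ∧ P = convexHull ℝ (S : Set V)

/-- A lattice polytope contains only finitely many points of any lattice, so that the
cardinality in `universalCounting` is a genuine one. -/
theorem IsLatticePolytope.finite_inter {V : Type*} [NormedAddCommGroup V] [NormedSpace ℝ V]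
    [FiniteDimensional ℝ V] {L₀ L : Submodule ℤ V} {P : Set V}
    (hP : IsLatticePolytope L₀ P) (hL : IsLattice L) : (P ∩ (L : Set V)).Finite := by
  obtain ⟨S, -, -, rfl⟩ := hP
  have : DiscreteTopology L := hL.choose
  have : ProperSpace V := FiniteDimensional.proper ℝ V
  have hb : Bornology.IsBounded (convexHull ℝ (S : Set V)) :=
    isBounded_convexHull.2 S.finite_toSet.isBounded
  have : DiscreteTopology L.toAddSubgroup := hL.choose
  exact Metric.finite_isBounded_inter_isClosed DiscreteTopology.isDiscrete hb
    (AddSubgroup.isClosed_of_discrete (H := L.toAddSubgroup))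

/-- The universal counting function of `P`, defined on all lattices `L` containing `L₀`,
by `L ↦ |P ∩ L|`. -/
noncomputable def universalCounting {V : Type*} [NormedAddCommGroup V] [NormedSpace ℝ V]
    (L₀ : Submodule ℤ V) (P : Set V) : latticesContaining L₀ → ℤ :=
  fun L => ((P ∩ ((L : Submodule ℤ V) : Set V)).ncard : ℤ)

/-- `P` is a lattice translate of `R`: `P = v + R` for some `v ∈ L₀`. -/
def IsLatticeTranslate {V : Type*} [NormedAddCommGroup V] [NormedSpace ℝ V]
    (L₀ : Submodule ℤ V) (P R : Set V) : Prop :=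
  ∃ v ∈ L₀, P = v +ᵥ R

/-! Choose a linear height that is injective on the lattice. A lattice polygon then has a unique
lowest and a unique highest vertex, joined by a right and a left chain of upward edges. Cut into
primitive vectors, the chains are two multisets `E`, `F` with equal sums. They determine the polygon
up to translation, and every such pair occurs. Minkowski addition adds the pairs, while negation
swaps the two members, so `X + Y` and `X - Y` have the same total multiset `E + F`.

Counting enters through Pick's formula (`IsEdgeRep.ncard_inter_eq`): in every lattice containing the
given one, the number of points is 1 plus half the lattice perimeter plus the area. The diagonal
from lowest to highest vertex cuts the polygon into half of the zonotope of `E` and half of the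
zonotope of `F`; zonotopes are centrally symmetric and can be counted by adding one segment at a
time.

Hence equal areas and equal total edges force equal counts. Conversely, counts in finer and finer
lattices give the area, so by Pick the perimeters agree in every larger lattice. Refining along one
primitive direction isolates its multiplicity (`eq_of_sum_latticeLength_eq`), so the total edges
agree. The edges that lie on the same side in `P` and `Q` then form `X`, and those that change sides
form `Y`. -/

open Module Submodule

/-! ### Lattice bases, lattice length and primitive vectors. -/

section Bases

variable {V : Type*} [NormedAddCommGroup V] [NormedSpace ℝ V]

theorem exists_basis_pair (b : Basis (Fin 2) ℝ V) (p q r s : ℝ) (h : p * s - q * r ≠ 0) :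
    ∃ B : Basis (Fin 2) ℝ V, B 0 = p • b 0 + q • b 1 ∧ B 1 = r • b 0 + s • b 1 := by
  have : FiniteDimensional ℝ V := b.finiteDimensional_of_finite
  have hli : LinearIndependent ℝ ![p • b 0 + q • b 1, r • b 0 + s • b 1] := by
    rw [LinearIndependent.pair_iff]
    intro x y hxy
    have hb : LinearIndependent ℝ ![b 0, b 1] := by
      convert b.linearIndependent using 1
      ext i; fin_cases i <;> rfl
    have h0 : (x * p + y * r) • b 0 + (x * q + y * s) • b 1 = 0 := by
      rw [← hxy]; module
    obtain ⟨h1, h2⟩ := LinearIndependent.pair_iff.1 hb _ _ h0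
    constructor
    · apply (mul_eq_zero.1 (_ : x * (p * s - q * r) = 0)).resolve_right h
      linear_combination s * h1 - r * h2
    · apply (mul_eq_zero.1 (_ : y * (p * s - q * r) = 0)).resolve_right h
      linear_combination p * h2 - q * h1
  refine ⟨basisOfLinearIndependentOfCardEqFinrank hli ?_, ?_, ?_⟩
  · rw [finrank_eq_card_basis b]
  · simp
  · simp

theorem mem_span_basis_iff (b : Basis (Fin 2) ℝ V) (z : V) :
    z ∈ span ℤ (Set.range b) ↔ ∃ i j : ℤ, z = (i : ℝ) • b 0 + (j : ℝ) • b 1 := by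
  have : Set.range b = {b 0, b 1} := by
    ext x; simp [Fin.exists_fin_two, eq_comm]
  rw [this, mem_span_pair]
  simp only [Int.cast_smul_eq_zsmul, eq_comm]

theorem repr_pair (b : Basis (Fin 2) ℝ V) (i j : ℝ) :
    b.repr (i • b 0 + j • b 1) 0 = i ∧ b.repr (i • b 0 + j • b 1) 1 = j := by
  constructor <;> simp

theorem eq_repr_pair (b : Basis (Fin 2) ℝ V) (z : V) :
    z = b.repr z 0 • b 0 + b.repr z 1 • b 1 := by
  rw [← Fin.sum_univ_two (f := fun i => b.repr z i • b i), b.sum_repr]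

/-- The largest integer dividing `e` in the lattice spanned by `b`; for the edge `e` of a polygon
this is its lattice length. -/
noncomputable def latticeLength (b : Basis (Fin 2) ℝ V) (e : V) : ℕ :=
  -- On lattice vectors the coordinates are integers, so the floors lose nothing; the zero vector
  -- gets length 0.
  Int.gcd ⌊b.repr e 0⌋ ⌊b.repr e 1⌋

theorem latticeLength_pair (b : Basis (Fin 2) ℝ V) (i j : ℤ) :
    latticeLength b ((i : ℝ) • b 0 + (j : ℝ) • b 1) = Int.gcd i j := by
  simp [latticeLength]

/-- Every lattice vector is a multiple of the first vector of some basis of the lattice. -/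
theorem exists_basis_latticeLength_smul (b : Basis (Fin 2) ℝ V) {e : V}
    (he : e ∈ span ℤ (Set.range b)) :
    ∃ B : Basis (Fin 2) ℝ V, span ℤ (Set.range B) = span ℤ (Set.range b) ∧
      e = (latticeLength b e : ℝ) • B 0 := by
  obtain ⟨i, j, rfl⟩ := (mem_span_basis_iff b e).1 he
  rw [latticeLength_pair]
  rcases Nat.eq_zero_or_pos (Int.gcd i j) with h | h
  · refine ⟨b, rfl, ?_⟩
    rw [Int.gcd_eq_zero_iff] at h
    simp [h.1, h.2]
  obtain ⟨k, l, hkl⟩ : ∃ k l : ℤ, i = Int.gcd i j * k ∧ j = Int.gcd i j * l := by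
    obtain ⟨k, hk⟩ := Int.gcd_dvd_left i j
    obtain ⟨l, hl⟩ := Int.gcd_dvd_right i j
    exact ⟨k, l, hk, hl⟩
  have hg : (Int.gcd i j : ℤ) ≠ 0 := by exact_mod_cast h.ne'
  -- Bézout coefficients complete the primitive vector `(k, l)` to an integer matrix of determinant
  -- 1.
  obtain ⟨u, v, huv⟩ : ∃ u v : ℤ, k * u + l * v = 1 := by
    refine ⟨Int.gcdA i j, Int.gcdB i j, mul_left_cancel₀ hg ?_⟩
    linear_combination -Int.gcd_eq_gcd_ab i j - Int.gcdA i j * hkl.1 - Int.gcdB i j * hkl.2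
  have huv' : (k : ℝ) * u + l * v = 1 := by exact_mod_cast huv
  obtain ⟨B, hB0, hB1⟩ := exists_basis_pair b k l (-v) u (by
    rw [show (k : ℝ) * u - l * -v = 1 by linear_combination huv']; exact one_ne_zero)
  refine ⟨B, le_antisymm ?_ ?_, ?_⟩
  · rw [span_le, Set.range_subset_iff, Fin.forall_fin_two]
    exact ⟨(mem_span_basis_iff b _).2 ⟨k, l, hB0⟩,
      (mem_span_basis_iff b _).2 ⟨-v, u, by rw [hB1]; push_cast; rfl⟩⟩
  · rw [span_le, Set.range_subset_iff, Fin.forall_fin_two]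
    refine ⟨(mem_span_basis_iff B _).2 ⟨u, -l, ?_⟩, (mem_span_basis_iff B _).2 ⟨v, k, ?_⟩⟩
    · rw [hB0, hB1]
      calc b 0 = ((k : ℝ) * u + l * v) • b 0 := by rw [huv', one_smul]
        _ = _ := by push_cast; module
    · rw [hB0, hB1]
      calc b 1 = ((k : ℝ) * u + l * v) • b 1 := by rw [huv', one_smul]
        _ = _ := by module
  · have h1 : (i : ℝ) = Int.gcd i j * k := by exact_mod_cast hkl.1
    have h2 : (j : ℝ) = Int.gcd i j * l := by exact_mod_cast hkl.2
    rw [hB0, smul_add, smul_smul, smul_smul, ← h1, ← h2]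

/-- A nonzero lattice vector that is not a proper multiple of another one. -/
def IsPrimitive (L : Submodule ℤ V) (e : V) : Prop :=
  -- The choice `k = 0`, `w = 0` excludes `e = 0`.
  e ∈ L ∧ ∀ (k : ℕ), ∀ w ∈ L, e = (k : ℝ) • w → k = 1

theorem IsPrimitive.latticeLength_eq {b : Basis (Fin 2) ℝ V} {e : V}
    (he : IsPrimitive (span ℤ (Set.range b)) e) : latticeLength b e = 1 := by
  obtain ⟨B, hB, heB⟩ := exists_basis_latticeLength_smul b he.1
  exact he.2 _ (B 0) (hB ▸ subset_span (Set.mem_range_self 0)) heB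

theorem isPrimitive_basis (B : Basis (Fin 2) ℝ V) :
    IsPrimitive (span ℤ (Set.range B)) (B 0) := by
  refine ⟨subset_span (Set.mem_range_self 0), fun k w hw h => ?_⟩
  obtain ⟨i, j, rfl⟩ := (mem_span_basis_iff B w).1 hw
  have h' := congrArg (fun z => B.repr z 0) h
  simp at h'
  have : (k : ℤ) * i = 1 := by exact_mod_cast h'.symm
  have := Int.eq_one_or_neg_one_of_mul_eq_one this
  omega

theorem exists_primitive_smul (b : Basis (Fin 2) ℝ V) {e : V}
    (he : e ∈ span ℤ (Set.range b)) :
    ∃ (g : ℕ) (u : V), IsPrimitive (span ℤ (Set.range b)) u ∧ e = (g : ℝ) • u := by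
  obtain ⟨B, hB, heB⟩ := exists_basis_latticeLength_smul b he
  exact ⟨_, B 0, hB ▸ isPrimitive_basis B, heB⟩

/-- There is a linear coordinate that separates the points of a given lattice. -/
theorem exists_basis_injOn (b : Basis (Fin 2) ℝ V) :
    ∃ c : Basis (Fin 2) ℝ V, ∀ z ∈ span ℤ (Set.range b), c.repr z 1 = 0 → z = 0 := by
  -- In this frame the second coordinate of `i • b 0 + j • b 1` is `i + √2 * j`, which vanishes only
  -- for `i = j = 0`.
  obtain ⟨c, h0, h1⟩ := exists_basis_pair b √2 (-1) 1 0 (by norm_num)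
  refine ⟨c, fun z hz h => ?_⟩
  obtain ⟨i, j, rfl⟩ := (mem_span_basis_iff b z).1 hz
  have : (i : ℝ) • b 0 + (j : ℝ) • b 1 = (-j : ℝ) • c 0 + (i + √2 * j) • c 1 := by
    rw [h0, h1]; module
  rw [this, (repr_pair c _ _).2] at h
  have hj : j = 0 := by
    by_contra hj
    apply irrational_sqrt_two.mul_intCast hj
    exact ⟨-i, by push_cast; linarith⟩
  subst hj
  have hi : (i : ℝ) = 0 := by simpa using h
  simp [hi]

end Bases

/-! ### Support functions, zonotopes and edge representations. -/

section Support

variable {V : Type*} [NormedAddCommGroup V] [NormedSpace ℝ V]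

/-- The support function of the zonotope generated by `E`. -/
noncomputable def posSum (E : Multiset V) (f : V →L[ℝ] ℝ) : ℝ :=
  (E.map fun e => max (f e) 0).sum

@[simp] theorem posSum_zero (f : V →L[ℝ] ℝ) : posSum (0 : Multiset V) f = 0 := by simp [posSum]

@[simp] theorem posSum_cons (e : V) (E : Multiset V) (f : V →L[ℝ] ℝ) :
    posSum (e ::ₘ E) f = max (f e) 0 + posSum E f := by simp [posSum]

@[simp] theorem posSum_add (E F : Multiset V) (f : V →L[ℝ] ℝ) :
    posSum (E + F) f = posSum E f + posSum F f := by simp [posSum]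

theorem posSum_nonneg (E : Multiset V) (f : V →L[ℝ] ℝ) : 0 ≤ posSum E f := by
  induction E using Multiset.induction with
  | empty => simp
  | cons e E ih => rw [posSum_cons]; positivity

theorem posSum_replicate (g : ℕ) (u : V) (f : V →L[ℝ] ℝ) :
    posSum (Multiset.replicate g u) f = max (f ((g : ℝ) • u)) 0 := by
  simp only [posSum, Multiset.map_replicate, Multiset.sum_replicate, map_smul, nsmul_eq_mul,
    smul_eq_mul]
  rw [mul_max_of_nonneg _ _ (Nat.cast_nonneg g), mul_zero]

theorem apply_sum_le_posSum (E : Multiset V) (f : V →L[ℝ] ℝ) : f E.sum ≤ posSum E f := by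
  induction E using Multiset.induction with
  | empty => simp
  | cons e E ih =>
    rw [posSum_cons, Multiset.sum_cons, map_add]
    exact add_le_add (le_max_left _ _) ih

theorem max_le_posSum (E : Multiset V) (f : V →L[ℝ] ℝ) : max (f E.sum) 0 ≤ posSum E f :=
  max_le (apply_sum_le_posSum E f) (posSum_nonneg E f)

/-- Since `max (-t) 0 = max t 0 - t`; this encodes the central symmetry of the zonotope about half
the sum of its generators. -/
theorem posSum_neg (E : Multiset V) (f : V →L[ℝ] ℝ) : posSum E (-f) = posSum E f - f E.sum := by
  induction E using Multiset.induction with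
  | empty => simp
  | cons e E ih =>
    simp only [posSum_cons, Multiset.sum_cons, map_add, ih, neg_apply]
    have : max (-f e) 0 = max (f e) 0 - f e := by
      rcases le_total (f e) 0 with h | h
      · rw [max_eq_left (by linarith), max_eq_right h]; ring
      · rw [max_eq_right (by linarith), max_eq_left h]; ring
    linarith

theorem apply_sum_le_posSum_of_le {T E : Multiset V} (h : T ≤ E) (f : V →L[ℝ] ℝ) :
    f T.sum ≤ posSum E f := by
  obtain ⟨U, rfl⟩ := Multiset.le_iff_exists_add.1 h
  rw [posSum_add]
  linarith [apply_sum_le_posSum T f, posSum_nonneg U f]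

/-- The generators on which `f` is positive add up to a point of the zonotope where `f` is maximal.
-/
theorem apply_sum_filter (E : Multiset V) (f : V →L[ℝ] ℝ) :
    f (E.filter fun e => 0 < f e).sum = posSum E f := by
  classical
  induction E using Multiset.induction with
  | empty => simp
  | cons e E ih =>
    by_cases h : 0 < f e
    · rw [Multiset.filter_cons_of_pos (p := fun e => 0 < f e) E h]
      simp [ih, max_eq_left h.le]
    · rw [Multiset.filter_cons_of_neg (p := fun e => 0 < f e) E h]
      simp [ih, max_eq_right (not_lt.1 h)]

theorem posSum_eq_max {E : Multiset V} {f : V →L[ℝ] ℝ}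
    (h : (∀ e ∈ E, 0 ≤ f e) ∨ ∀ e ∈ E, f e ≤ 0) : posSum E f = max (f E.sum) 0 := by
  have aux : ∀ f : V →L[ℝ] ℝ, (∀ e ∈ E, 0 ≤ f e) → posSum E f = f E.sum ∧ 0 ≤ f E.sum := by
    clear h
    intro f h
    induction E using Multiset.induction with
    | empty => simp
    | cons e E ih =>
      rw [Multiset.forall_mem_cons] at h
      obtain ⟨h1, h2⟩ := ih h.2
      simp only [posSum_cons, Multiset.sum_cons, map_add, h1, max_eq_left h.1, true_and]
      linarith [h.1]
  rcases h with h | h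
  · rw [max_eq_left (aux f h).2, (aux f h).1]
  · have := aux (-f) (by simpa using h)
    simp only [posSum_neg, neg_apply] at this
    rw [max_eq_right (by linarith)]; linarith

/-- A closed convex set consists of the points that satisfy the inequalities given by its support
function. -/
theorem mem_iff_forall_le_of_isGreatest {P : Set V} (hP : Convex ℝ P) (hc : IsClosed P)
    {h : (V →L[ℝ] ℝ) → ℝ} (hh : ∀ f : V →L[ℝ] ℝ, IsGreatest (f '' P) (h f)) (z : V) :
    z ∈ P ↔ ∀ f : V →L[ℝ] ℝ, f z ≤ h f := by
  refine ⟨fun hz f => (hh f).2 ⟨z, hz, rfl⟩, fun hz => ?_⟩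
  by_contra hn
  obtain ⟨f, u, h1, h2⟩ := geometric_hahn_banach_closed_point hP hc hn
  obtain ⟨⟨w, hw, hwf⟩, -⟩ := hh f
  linarith [h1 w hw, hz f]

theorem IsGreatest.image_add {P Q : Set V} {f : V →L[ℝ] ℝ} {a b : ℝ}
    (hP : IsGreatest (f '' P) a) (hQ : IsGreatest (f '' Q) b) :
    IsGreatest (f '' (P + Q)) (a + b) := by
  obtain ⟨⟨p, hp, rfl⟩, hP⟩ := hP
  obtain ⟨⟨q, hq, rfl⟩, hQ⟩ := hQ
  refine ⟨⟨p + q, Set.add_mem_add hp hq, map_add _ _ _⟩, ?_⟩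
  rintro _ ⟨_, ⟨x, hx, y, hy, rfl⟩, rfl⟩
  rw [map_add]
  exact add_le_add (hP ⟨x, hx, rfl⟩) (hQ ⟨y, hy, rfl⟩)

theorem isGreatest_image_convexHull {S : Set V} {f : V →L[ℝ] ℝ} {a : ℝ}
    (h : IsGreatest (f '' S) a) : IsGreatest (f '' convexHull ℝ S) a := by
  refine ⟨Set.image_mono (subset_convexHull ℝ S) h.1, ?_⟩
  rintro _ ⟨x, hx, rfl⟩
  exact convexHull_min (t := {x | f x ≤ a}) (fun x hx => h.2 ⟨x, hx, rfl⟩)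
    (convex_halfSpace_le f.isLinear a) hx

/-- The Minkowski sum of the segments from the origin to the elements of `E`. -/
noncomputable def zonotope (E : Multiset V) : Set V := (E.map fun e => segment ℝ 0 e).sum

@[simp] theorem zonotope_zero : zonotope (0 : Multiset V) = {0} := by
  simp [zonotope, Set.singleton_zero]

theorem zonotope_cons (e : V) (E : Multiset V) :
    zonotope (e ::ₘ E) = zonotope E + segment ℝ 0 e := by
  simp [zonotope, add_comm]

theorem isGreatest_image_segment (e : V) (f : V →L[ℝ] ℝ) :
    IsGreatest (f '' segment ℝ 0 e) (max (f e) 0) := by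
  rw [← convexHull_pair]
  apply isGreatest_image_convexHull
  rw [Set.image_pair, map_zero, max_comm]
  exact isGreatest_pair

theorem isGreatest_image_zonotope (E : Multiset V) (f : V →L[ℝ] ℝ) :
    IsGreatest (f '' zonotope E) (posSum E f) := by
  induction E using Multiset.induction with
  | empty => simp [isGreatest_singleton]
  | cons e E ih =>
    rw [zonotope_cons, posSum_cons, add_comm (max _ _)]
    exact ih.image_add (isGreatest_image_segment e f)

theorem convex_zonotope (E : Multiset V) : Convex ℝ (zonotope E) := by
  induction E using Multiset.induction with
  | empty => simp
  | cons e E ih => rw [zonotope_cons]; exact ih.add (convex_segment _ _)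

theorem isCompact_zonotope (E : Multiset V) : IsCompact (zonotope E) := by
  induction E using Multiset.induction with
  | empty => simp
  | cons e E ih =>
    rw [zonotope_cons]
    refine ih.add ?_
    rw [← convexHull_pair]
    exact (Set.toFinite _).isCompact_convexHull ℝ

theorem mem_zonotope_iff (E : Multiset V) (z : V) :
    z ∈ zonotope E ↔ ∀ f : V →L[ℝ] ℝ, f z ≤ posSum E f :=
  mem_iff_forall_le_of_isGreatest (convex_zonotope E) (isCompact_zonotope E).isClosed
    (isGreatest_image_zonotope E) z

theorem sum_sub_mem_zonotope {E : Multiset V} {z : V} (hz : z ∈ zonotope E) :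
    E.sum - z ∈ zonotope E := by
  rw [mem_zonotope_iff] at hz ⊢
  intro f
  have := hz (-f)
  rw [posSum_neg, neg_apply] at this
  rw [map_sub]; linarith

/-- In the frame `c`, a convex polygon `P` with lowest vertex `p` whose edges, all directed
upwards, are the elements of `E` on the right side and of `F` on the left side. -/
structure IsEdgeRep (c : Basis (Fin 2) ℝ V) (P : Set V) (p : V) (E F : Multiset V) : Prop where
  convex : Convex ℝ P
  isCompact : IsCompact P
  pos_right : ∀ e ∈ E, 0 < c.repr e 1
  pos_left : ∀ e ∈ F, 0 < c.repr e 1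
  sum_eq : E.sum = F.sum
  right : ∀ f : V →L[ℝ] ℝ, 0 ≤ f (c 0) → IsGreatest (f '' P) (f p + posSum E f)
  left : ∀ f : V →L[ℝ] ℝ, f (c 0) ≤ 0 → IsGreatest (f '' P) (f p + posSum F f)

variable {c : Basis (Fin 2) ℝ V} {P Q : Set V} {p q : V} {E F E' F' : Multiset V}

/-- Support functions are additive under Minkowski sums, so the chains are merged side by side. -/
theorem IsEdgeRep.add (hP : IsEdgeRep c P p E F) (hQ : IsEdgeRep c Q q E' F') :
    IsEdgeRep c (P + Q) (p + q) (E + E') (F + F') where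
  convex := hP.convex.add hQ.convex
  isCompact := hP.isCompact.add hQ.isCompact
  pos_right e he := (Multiset.mem_add.1 he).elim (hP.pos_right e) (hQ.pos_right e)
  pos_left e he := (Multiset.mem_add.1 he).elim (hP.pos_left e) (hQ.pos_left e)
  sum_eq := by rw [Multiset.sum_add, Multiset.sum_add, hP.sum_eq, hQ.sum_eq]
  right f hf := by
    convert (hP.right f hf).image_add (hQ.right f hf) using 1
    rw [map_add, posSum_add]; ring
  left f hf := by
    convert (hP.left f hf).image_add (hQ.left f hf) using 1
    rw [map_add, posSum_add]; ring

/-- Reflection exchanges left and right and turns the highest vertex `p + E.sum` into the lowest;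
reversed to point upwards again, the edges are the same vectors. -/
theorem IsEdgeRep.neg (hP : IsEdgeRep c P p E F) :
    IsEdgeRep c (-P) (-(p + E.sum)) F E where
  convex := hP.convex.neg
  isCompact := hP.isCompact.neg
  pos_right := hP.pos_left
  pos_left := hP.pos_right
  sum_eq := hP.sum_eq.symm
  right f hf := by
    convert hP.left (-f) (by simpa using hf) using 1
    · rw [← Set.image_neg_eq_neg, Set.image_image]; simp
    · rw [posSum_neg, hP.sum_eq, map_neg, map_add, neg_apply]; ring
  left f hf := by
    convert hP.right (-f) (by simpa using hf) using 1
    · rw [← Set.image_neg_eq_neg, Set.image_image]; simp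
    · rw [posSum_neg, map_neg, map_add, neg_apply]; ring

theorem IsEdgeRep.mem_iff (hP : IsEdgeRep c P p E F) (z : V) :
    z ∈ P ↔ ∀ f : V →L[ℝ] ℝ, (0 ≤ f (c 0) → f (z - p) ≤ posSum E f) ∧
      (f (c 0) ≤ 0 → f (z - p) ≤ posSum F f) := by
  constructor
  · intro hz f
    rw [map_sub]
    exact ⟨fun h => by linarith [(hP.right f h).2 ⟨z, hz, rfl⟩],
      fun h => by linarith [(hP.left f h).2 ⟨z, hz, rfl⟩]⟩
  · intro hz
    classical
    refine (mem_iff_forall_le_of_isGreatest hP.convex hP.isCompact.isClosed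
      (h := fun f : V →L[ℝ] ℝ => if 0 ≤ f (c 0) then f p + posSum E f else f p + posSum F f) ?_ z).2 ?_
    · intro f
      split_ifs with h
      exacts [hP.right f h, hP.left f (not_le.1 h).le]
    · intro f
      have := hz f
      rw [map_sub] at this
      split_ifs with h
      · linarith [this.1 h]
      · linarith [this.2 (not_le.1 h).le]

theorem IsEdgeRep.eq_vadd (hP : IsEdgeRep c P p E F) (hQ : IsEdgeRep c Q q E F) :
    P = (p - q) +ᵥ Q := by
  ext z
  rw [Set.mem_vadd_set_iff_neg_vadd_mem, hP.mem_iff, hQ.mem_iff]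
  simp only [vadd_eq_add, show -(p - q) + z - q = z - p by abel]

theorem ContinuousLinearMap.apply_eq_repr (c : Basis (Fin 2) ℝ V) (f : V →L[ℝ] ℝ) (z : V) :
    f z = c.repr z 0 * f (c 0) + c.repr z 1 * f (c 1) := by
  conv_lhs => rw [eq_repr_pair c z]
  simp

/-- If `x` lies between `0` and `s` in height and on one side of the line through `0` and `s`, a
functional pointing to the other side attains its maximum over `0`, `s`, `x` at `0` or `s`. -/
theorem apply_le_max_of_side (c : Basis (Fin 2) ℝ V) {f f' : V →L[ℝ] ℝ} {x s : V}
    (h0 : 0 ≤ c.repr x 1) (h1 : c.repr x 1 ≤ c.repr s 1) (h2 : f' s ≤ f' x) (h3 : 0 ≤ f' x)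
    (h4 : f' (c 0) ≠ 0) (h5 : f' (c 0) * f (c 0) ≤ 0) : f x ≤ max (f s) 0 := by
  set k := f' (c 0) with hk
  -- With this `r`, `f + r • f'` kills `c 0` and is therefore a multiple of the height.
  set r := -(f (c 0) / k) with hr
  have hr0 : 0 ≤ r := by
    have : f (c 0) / k = (k * f (c 0)) / k ^ 2 := by field_simp
    rw [hr, this]
    have := div_nonpos_of_nonpos_of_nonneg h5 (sq_nonneg k)
    linarith
  have hrk : r * k = - f (c 0) := by rw [hr]; field_simp
  have key : ∀ z, f z = -(r * f' z) + (f (c 1) + r * f' (c 1)) * c.repr z 1 := by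
    intro z
    rw [f.apply_eq_repr c z, f'.apply_eq_repr c z, ← hk]
    linear_combination (c.repr z 0) * hrk
  rw [key x, key s]
  have := mul_le_mul_of_nonneg_left h2 hr0
  have := mul_nonneg hr0 h3
  rcases le_total 0 (f (c 1) + r * f' (c 1)) with h | h
  · apply le_max_of_le_left
    have := mul_le_mul_of_nonneg_left h1 h
    linarith
  · apply le_max_of_le_right
    have := mul_nonpos_of_nonpos_of_nonneg h h0
    linarith

end Support

/-! ### Polygons correspond to pairs of edge chains. -/

section EdgeRep

variable {V : Type*} [NormedAddCommGroup V] [NormedSpace ℝ V]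

/-- The right boundary chain of a finite set of lattice points, from its lowest point `p` to its
highest point `q`. -/
theorem exists_chain (c : Basis (Fin 2) ℝ V) (L : Submodule ℤ V)
    (hinj : ∀ z ∈ L, c.repr z 1 = 0 → z = 0)
    (hprim : ∀ e ∈ L, ∃ (g : ℕ) (u : V), IsPrimitive L u ∧ e = (g : ℝ) • u)
    (S : Finset V) (hne : S.Nonempty) (hS : (S : Set V) ⊆ L) :
    ∃ p ∈ S, ∃ q ∈ S, ∃ E : Multiset V, (∀ z ∈ S, c.repr p 1 ≤ c.repr z 1) ∧
      (∀ z ∈ S, c.repr z 1 ≤ c.repr q 1) ∧ (∀ e ∈ E, IsPrimitive L e ∧ 0 < c.repr e 1) ∧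
      E.sum = q - p ∧
      ∀ f : V →L[ℝ] ℝ, 0 ≤ f (c 0) → IsGreatest (f '' (S : Set V)) (f p + posSum E f) := by
  classical
  have hinj' : ∀ z ∈ S, ∀ w ∈ S, c.repr z 1 = c.repr w 1 → z = w := by
    intro z hz w hw h
    exact sub_eq_zero.1 (hinj _ (L.sub_mem (hS hz) (hS hw)) (by simp [h]))
  induction S using Finset.strongInduction with
  | H S ih =>
  obtain ⟨q, hq, hqmax⟩ := S.exists_max_image (fun z => c.repr z 1) hne
  by_cases hs : ∀ z ∈ S, z = q
  · refine ⟨q, hq, q, hq, 0, fun z hz => by rw [hs z hz], hqmax, by simp, by simp, ?_⟩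
    intro f _
    have : S = {q} := Finset.eq_singleton_iff_unique_mem.2 ⟨hq, hs⟩
    simp [this]
  push Not at hs
  obtain ⟨z₀, hz₀, hz₀q⟩ := hs
  have hlt : ∀ z ∈ S.erase q, c.repr z 1 < c.repr q 1 := by
    intro z hz
    rw [Finset.mem_erase] at hz
    exact lt_of_le_of_ne (hqmax z hz.2) fun h => hz.1 (hinj' z hz.2 q hq h)
  -- The next vertex below `q` on the right chain: the line through `v` and `q` has all of `S` on
  -- its left.
  obtain ⟨v, hv, hvmax⟩ := (S.erase q).exists_max_image
    (fun z => (c.repr z 0 - c.repr q 0) / (c.repr q 1 - c.repr z 1))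
    ⟨z₀, Finset.mem_erase.2 ⟨hz₀q, hz₀⟩⟩
  have hvS := Finset.mem_of_mem_erase hv
  have hvq := hlt v hv
  set σ := (c.repr v 0 - c.repr q 0) / (c.repr q 1 - c.repr v 1) with hσ
  have hσv : c.repr v 0 + σ * c.repr v 1 = c.repr q 0 + σ * c.repr q 1 := by
    have : c.repr q 1 - c.repr v 1 ≠ 0 := by linarith
    rw [hσ]; field_simp; ring
  have hσz : ∀ z ∈ S, c.repr z 0 + σ * c.repr z 1 ≤ c.repr q 0 + σ * c.repr q 1 := by
    intro z hz
    by_cases hzq : z = q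
    · rw [hzq]
    have hz' := Finset.mem_erase.2 ⟨hzq, hz⟩
    have h1 := hvmax z hz'
    have h2 := hlt z hz'
    rw [div_le_iff₀ (by linarith)] at h1
    linarith
  -- Points higher than `v` are dropped; the chain of the rest ends at `v`, and the edge from `v` to
  -- `q` is appended.
  set S' := S.filter fun z => c.repr z 1 ≤ c.repr v 1 with hS'
  have hsub : S' ⊆ S := Finset.filter_subset _ _
  have hssub : S' ⊂ S := Finset.filter_ssubset.2 ⟨q, hq, not_le.2 hvq⟩
  have hvS' : v ∈ S' := Finset.mem_filter.2 ⟨hvS, le_rfl⟩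
  obtain ⟨p, hp, q', hq', E, hpmin, hqmax', hE, hsum, hgr⟩ := ih S' hssub ⟨v, hvS'⟩
    (fun z hz => hS (hsub hz)) fun z hz w hw => hinj' z (hsub hz) w (hsub hw)
  obtain rfl : q' = v := hinj' _ (hsub hq') _ hvS
    (le_antisymm (Finset.mem_filter.1 hq').2 (hqmax' v hvS'))
  obtain ⟨g, u, hu, hgu⟩ := hprim (q - q') (L.sub_mem (hS hq) (hS hvS))
  refine ⟨p, hsub hp, q, hq, E + Multiset.replicate g u, ?_, hqmax, ?_, ?_, ?_⟩
  · intro z hz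
    by_cases h : c.repr z 1 ≤ c.repr q' 1
    · exact hpmin z (Finset.mem_filter.2 ⟨hz, h⟩)
    · exact (hpmin q' hvS').trans (not_le.1 h).le
  · intro e he
    rcases Multiset.mem_add.1 he with he | he
    · exact hE e he
    · rw [Multiset.eq_of_mem_replicate he]
      refine ⟨hu, ?_⟩
      have h1 := congrArg (fun z => c.repr z 1) hgu
      simp only [map_sub, Finsupp.sub_apply, map_smul, Finsupp.smul_apply, smul_eq_mul] at h1
      exact pos_of_mul_pos_right (a := (g : ℝ)) (by linarith) (Nat.cast_nonneg g)
  · rw [Multiset.sum_add, hsum, Multiset.sum_replicate, ← Nat.cast_smul_eq_nsmul ℝ, ← hgu]; abel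
  · intro f hf
    rw [posSum_add, posSum_replicate, ← hgu, map_sub]
    have hg' := hgr f hf
    have hfz : ∀ z, f z = f (c 0) * (c.repr z 0 + σ * c.repr z 1) +
        (f (c 1) - f (c 0) * σ) * c.repr z 1 := fun z => by
      rw [f.apply_eq_repr c z]; ring
    -- By `hfz`, `f` is a nonnegative multiple of the functional defining the edge line plus a
    -- multiple of the height. The sign of the latter decides whether `f` increases along the new
    -- edge.
    rcases le_total 0 (f (c 1) - f (c 0) * σ) with h | h
    · have hv1 : IsGreatest (f '' (S' : Set V)) (f q') := by
        refine ⟨⟨q', hvS', rfl⟩, ?_⟩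
        rintro _ ⟨z, hz, rfl⟩
        rw [hfz z, hfz q', hσv]
        exact add_le_add (mul_le_mul_of_nonneg_left (hσz z (hsub hz)) hf)
          (mul_le_mul_of_nonneg_left (Finset.mem_filter.1 hz).2 h)
      have hle : f q' ≤ f q := by
        rw [hfz q, hfz q', hσv]
        exact add_le_add le_rfl (mul_le_mul_of_nonneg_left hvq.le h)
      have heq := hg'.unique hv1
      rw [max_eq_left (by linarith), show f p + (posSum E f + (f q - f q')) = f q by linarith]
      refine ⟨⟨q, hq, rfl⟩, ?_⟩
      rintro _ ⟨z, hz, rfl⟩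
      rw [hfz z, hfz q]
      exact add_le_add (mul_le_mul_of_nonneg_left (hσz z hz) hf)
        (mul_le_mul_of_nonneg_left (hqmax z hz) h)
    · have hle : f q ≤ f q' := by
        rw [hfz q, hfz q', hσv]
        exact add_le_add le_rfl (mul_le_mul_of_nonpos_left hvq.le h)
      rw [max_eq_right (by linarith), add_zero]
      refine ⟨Set.image_mono (Finset.coe_subset.2 hsub) hg'.1, ?_⟩
      rintro _ ⟨z, hz, rfl⟩
      by_cases hz' : c.repr z 1 ≤ c.repr q' 1
      · exact hg'.2 ⟨z, Finset.mem_filter.2 ⟨hz, hz'⟩, rfl⟩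
      · refine le_trans ?_ (hg'.2 ⟨q', hvS', rfl⟩)
        rw [hfz z, hfz q', hσv]
        exact add_le_add (mul_le_mul_of_nonneg_left (hσz z hz) hf)
          (mul_le_mul_of_nonpos_left (not_le.1 hz').le h)

/-- Every lattice polygon is determined by its primitive edge vectors. -/
theorem IsLatticePolytope.exists_isEdgeRep (c : Basis (Fin 2) ℝ V) {L : Submodule ℤ V}
    (hinj : ∀ z ∈ L, c.repr z 1 = 0 → z = 0)
    (hprim : ∀ e ∈ L, ∃ (g : ℕ) (u : V), IsPrimitive L u ∧ e = (g : ℝ) • u)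
    {P : Set V} (hP : IsLatticePolytope L P) :
    ∃ p ∈ L, ∃ E F : Multiset V, (∀ e ∈ E, IsPrimitive L e) ∧ (∀ e ∈ F, IsPrimitive L e) ∧
      IsEdgeRep c P p E F := by
  obtain ⟨S, hne, hS, rfl⟩ := hP
  -- The mirrored frame has the same height, and its right chain is the left chain of `c`.
  obtain ⟨c', h0, h1⟩ := exists_basis_pair c (-1) 0 0 1 (by norm_num)
  have hc' : ∀ z, c'.repr z 1 = c.repr z 1 := by
    intro z
    have : z = (-c.repr z 0) • c' 0 + c.repr z 1 • c' 1 := by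
      rw [h0, h1]
      conv_lhs => rw [eq_repr_pair c z]
      module
    conv_lhs => rw [this]
    exact (repr_pair c' _ _).2
  obtain ⟨p, hp, q, hq, E, hpm, hqm, hE, hEs, hEg⟩ := exists_chain c L hinj hprim S hne hS
  obtain ⟨p', hp', q', hq', F, hpm', hqm', hF, hFs, hFg⟩ :=
    exists_chain c' L (by simpa only [hc'] using hinj) hprim S hne hS
  simp only [hc'] at hpm' hqm' hF
  have hinj' : ∀ z ∈ S, ∀ w ∈ S, c.repr z 1 = c.repr w 1 → z = w := by
    intro z hz w hw h
    exact sub_eq_zero.1 (hinj _ (L.sub_mem (hS hz) (hS hw)) (by simp [h]))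
  obtain rfl := hinj' p hp p' hp' (le_antisymm (hpm _ hp') (hpm' _ hp))
  obtain rfl := hinj' q hq q' hq' (le_antisymm (hqm' _ hq) (hqm _ hq'))
  exact ⟨p, hS hp, E, F, fun e he => (hE e he).1, fun e he => (hF e he).1,
    { convex := convex_convexHull ℝ _
      isCompact := S.finite_toSet.isCompact_convexHull ℝ
      pos_right := fun e he => (hE e he).2
      pos_left := fun e he => (hF e he).2
      sum_eq := by rw [hEs, hFs]
      right := fun f hf => isGreatest_image_convexHull (hEg f hf)
      left := fun f hf => isGreatest_image_convexHull (hFg f (by simpa [h0] using hf)) }⟩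

theorem repr_sum_nonneg {c : Basis (Fin 2) ℝ V} {E : Multiset V} (h : ∀ e ∈ E, 0 < c.repr e 1) :
    0 ≤ c.repr E.sum 1 := by
  induction E using Multiset.induction with
  | empty => simp
  | cons e E ih =>
    rw [Multiset.forall_mem_cons] at h
    simp only [Multiset.sum_cons, map_add, Finsupp.add_apply]
    linarith [h.1, ih h.2]

theorem repr_sum_le_of_le {c : Basis (Fin 2) ℝ V} {T E : Multiset V} (hT : T ≤ E)
    (h : ∀ e ∈ E, 0 < c.repr e 1) : 0 ≤ c.repr T.sum 1 ∧ c.repr T.sum 1 ≤ c.repr E.sum 1 := by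
  obtain ⟨U, rfl⟩ := Multiset.le_iff_exists_add.1 hT
  have h1 := repr_sum_nonneg (c := c) (E := T) fun e he => h e (Multiset.mem_add.2 (Or.inl he))
  have h2 := repr_sum_nonneg (c := c) (E := U) fun e he => h e (Multiset.mem_add.2 (Or.inr he))
  simp only [Multiset.sum_add, map_add, Finsupp.add_apply]
  exact ⟨h1, by linarith⟩

theorem posSum_eq_max_of_apply_eq_zero {c : Basis (Fin 2) ℝ V} {E : Multiset V}
    (h : ∀ e ∈ E, 0 < c.repr e 1) {f : V →L[ℝ] ℝ} (hf : f (c 0) = 0) :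
    posSum E f = max (f E.sum) 0 := by
  apply posSum_eq_max
  rcases le_total 0 (f (c 1)) with h1 | h1
  · refine Or.inl fun e he => ?_
    rw [f.apply_eq_repr c, hf, mul_zero, zero_add]
    exact mul_nonneg (h e he).le h1
  · refine Or.inr fun e he => ?_
    rw [f.apply_eq_repr c, hf, mul_zero, zero_add]
    exact mul_nonpos_of_nonneg_of_nonpos (h e he).le h1

theorem sum_mem_of_le {W : Type*} [AddCommGroup W] {L : Submodule ℤ W} {T E : Multiset W} (hT : T ≤ E) (h : ∀ e ∈ E, e ∈ L) :
    T.sum ∈ L :=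
  multiset_sum_mem _ fun e he => h e (Multiset.mem_of_le hT he)

/-- Any two multisets of upward lattice vectors with the same sum are the edges of a lattice
polygon. -/
theorem exists_isLatticePolytope_isEdgeRep (c : Basis (Fin 2) ℝ V) {L : Submodule ℤ V}
    {E F : Multiset V} (hE : ∀ e ∈ E, 0 < c.repr e 1) (hF : ∀ e ∈ F, 0 < c.repr e 1)
    (hs : E.sum = F.sum) (hEL : ∀ e ∈ E, e ∈ L) (hFL : ∀ e ∈ F, e ∈ L) :
    ∃ P, IsLatticePolytope L P ∧ IsEdgeRep c P 0 E F := by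
  classical
  let v : Multiset V → (V →L[ℝ] ℝ) → V := fun E f => (E.filter fun e => 0 < f e).sum
  have hvle : ∀ (E : Multiset V) (f : V →L[ℝ] ℝ), (E.filter fun e => 0 < f e) ≤ E :=
    fun E f => Multiset.filter_le _ _
  -- The vertices of the right and left chains. The functionals are infinitely many, but only
  -- finitely many subsums arise.
  let A : Set V := {z | ∃ f : V →L[ℝ] ℝ, 0 < f (c 0) ∧ v E f = z}
  let B : Set V := {z | ∃ f : V →L[ℝ] ℝ, f (c 0) < 0 ∧ v F f = z}
  have hsubs : ∀ E : Multiset V, {z | ∃ T ≤ E, T.sum = z}.Finite := by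
    intro E
    refine ((E.powerset.map Multiset.sum).toFinset.finite_toSet).subset ?_
    rintro _ ⟨T, hT, rfl⟩
    simp only [Finset.mem_coe, Multiset.mem_toFinset, Multiset.mem_map, Multiset.mem_powerset]
    exact ⟨T, hT, rfl⟩
  have hA : A.Finite := (hsubs E).subset fun z ⟨f, _, hz⟩ => ⟨_, hvle E f, hz⟩
  have hB : B.Finite := (hsubs F).subset fun z ⟨f, _, hz⟩ => ⟨_, hvle F f, hz⟩
  have hfin : (A ∪ B ∪ {0, E.sum}).Finite := (hA.union hB).union (Set.toFinite _)
  have hmem0 : (0 : V) ∈ A ∪ B ∪ {0, E.sum} := by simp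
  have hmems : E.sum ∈ A ∪ B ∪ {0, E.sum} := by simp
  have hmaxE : ∀ f : V →L[ℝ] ℝ, max (f E.sum) 0 ≤ posSum E f := max_le_posSum E
  have hmaxF : ∀ f : V →L[ℝ] ℝ, max (f E.sum) 0 ≤ posSum F f := hs ▸ max_le_posSum F
  have right : ∀ f : V →L[ℝ] ℝ, 0 ≤ f (c 0) →
      IsGreatest (f '' (A ∪ B ∪ {0, E.sum})) (posSum E f) := by
    intro f hf
    constructor
    · rcases hf.eq_or_lt with hf | hf
      · rw [posSum_eq_max_of_apply_eq_zero hE hf.symm]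
        rcases max_choice (f E.sum) 0 with h | h
        · exact ⟨_, hmems, h.symm⟩
        · exact ⟨_, hmem0, by rw [h, map_zero]⟩
      · exact ⟨v E f, Or.inl (Or.inl ⟨f, hf, rfl⟩), apply_sum_filter E f⟩
    · rintro _ ⟨z, ((⟨f', hf', rfl⟩ | ⟨f', hf', rfl⟩) | rfl | rfl), rfl⟩
      · exact apply_sum_le_posSum_of_le (hvle E f') f
      · refine le_trans ?_ (hmaxE f)
        have hy := repr_sum_le_of_le (hvle F f') hF
        have h2 := max_le_posSum F f'
        rw [← apply_sum_filter F f', max_le_iff] at h2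
        rw [hs]
        -- A left vertex cannot exceed the endpoints of the diagonal for a functional pointing
        -- right.
        exact apply_le_max_of_side c hy.1 hy.2 h2.1 h2.2 hf'.ne
          (mul_nonpos_of_nonpos_of_nonneg hf'.le hf)
      · rw [map_zero]; exact posSum_nonneg E f
      · exact apply_sum_le_posSum E f
  have left : ∀ f : V →L[ℝ] ℝ, f (c 0) ≤ 0 →
      IsGreatest (f '' (A ∪ B ∪ {0, E.sum})) (posSum F f) := by
    intro f hf
    constructor
    · rcases hf.eq_or_lt with hf | hf
      · rw [posSum_eq_max_of_apply_eq_zero hF hf, ← hs]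
        rcases max_choice (f E.sum) 0 with h | h
        · exact ⟨_, hmems, h.symm⟩
        · exact ⟨_, hmem0, by rw [h, map_zero]⟩
      · exact ⟨v F f, Or.inl (Or.inr ⟨f, hf, rfl⟩), apply_sum_filter F f⟩
    · rintro _ ⟨z, ((⟨f', hf', rfl⟩ | ⟨f', hf', rfl⟩) | rfl | rfl), rfl⟩
      · refine le_trans ?_ (hmaxF f)
        have hy := repr_sum_le_of_le (hvle E f') hE
        have h2 := max_le_posSum E f'
        rw [← apply_sum_filter E f', max_le_iff] at h2
        exact apply_le_max_of_side c hy.1 hy.2 h2.1 h2.2 hf'.ne'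
          (mul_nonpos_of_nonneg_of_nonpos hf'.le hf)
      · exact apply_sum_le_posSum_of_le (hvle F f') f
      · rw [map_zero]; exact posSum_nonneg F f
      · rw [hs]; exact apply_sum_le_posSum F f
  refine ⟨convexHull ℝ (A ∪ B ∪ {0, E.sum}), ⟨hfin.toFinset, ?_, ?_, ?_⟩, ?_⟩
  · exact ⟨0, by simp⟩
  · rw [Set.Finite.coe_toFinset]
    rintro _ ((⟨f', hf', rfl⟩ | ⟨f', hf', rfl⟩) | rfl | rfl)
    · exact sum_mem_of_le (hvle E f') hEL
    · exact sum_mem_of_le (hvle F f') hFL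
    · exact L.zero_mem
    · exact sum_mem_of_le le_rfl hEL
  · rw [Set.Finite.coe_toFinset]
  · exact
    { convex := convex_convexHull ℝ _
      isCompact := hfin.isCompact_convexHull ℝ
      pos_right := hE
      pos_left := hF
      sum_eq := hs
      right := fun f hf => by
        rw [map_zero, zero_add]; exact isGreatest_image_convexHull (right f hf)
      left := fun f hf => by
        rw [map_zero, zero_add]; exact isGreatest_image_convexHull (left f hf) }

variable {c : Basis (Fin 2) ℝ V} {P : Set V} {p : V} {E F : Multiset V}

theorem repr_le_of_apply_le {s x : V} {E : Multiset V} (hE : ∀ e ∈ E, 0 < c.repr e 1)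
    (hs : E.sum = s) (h : ∀ f : V →L[ℝ] ℝ, f (c 0) = 0 → f x ≤ posSum E f) :
    0 ≤ c.repr x 1 ∧ c.repr x 1 ≤ c.repr s 1 := by
  have : FiniteDimensional ℝ V := c.finiteDimensional_of_finite
  let y : V →L[ℝ] ℝ := (c.coord 1).toContinuousLinearMap
  have hy : ∀ z, y z = c.repr z 1 := fun z => rfl
  have hy0 : y (c 0) = 0 := by simp [hy]
  have h0 := repr_sum_nonneg hE
  have h1 := h y hy0
  have h2 := h (-y) (by simp [hy0])
  rw [posSum_neg, posSum_eq_max_of_apply_eq_zero hE hy0, neg_apply] at h2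
  rw [posSum_eq_max_of_apply_eq_zero hE hy0] at h1
  rw [hs] at *
  simp only [hy] at h1 h2
  rw [max_eq_left h0] at h1 h2
  exact ⟨by linarith, h1⟩

/-- On the right side of the diagonal through its lowest and highest vertices, a polygon coincides
with the zonotope generated by its right edges. -/
theorem IsEdgeRep.mem_iff_of_nonneg (hP : IsEdgeRep c P p E F) {r : V →L[ℝ] ℝ}
    (hr : r (c 0) = 1) (hrs : r E.sum = 0) {z : V} (hz : 0 ≤ r (z - p)) :
    z ∈ P ↔ z - p ∈ zonotope E := by
  rw [hP.mem_iff, mem_zonotope_iff]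
  -- To the right of the diagonal and within the height range, the constraints from functionals
  -- pointing left are automatic, so only `E` matters.
  have side : 0 ≤ c.repr (z - p) 1 → c.repr (z - p) 1 ≤ c.repr E.sum 1 →
      ∀ f : V →L[ℝ] ℝ, f (c 0) ≤ 0 → f (z - p) ≤ max (f E.sum) 0 := fun h0 h1 f hf =>
    apply_le_max_of_side c h0 h1 (f' := r) (by rw [hrs]; exact hz) hz (by rw [hr]; norm_num)
      (by rw [hr, one_mul]; exact hf)
  constructor
  · intro h f
    rcases le_total 0 (f (c 0)) with hf | hf
    · exact (h f).1 hf
    · obtain ⟨h0, h1⟩ := repr_le_of_apply_le hP.pos_right rfl fun f hf => (h f).1 hf.ge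
      exact (side h0 h1 f hf).trans (max_le_posSum E f)
  · intro h f
    refine ⟨fun _ => h f, fun hf => ?_⟩
    obtain ⟨h0, h1⟩ := repr_le_of_apply_le hP.pos_right rfl fun f _ => h f
    exact (side h0 h1 f hf).trans (hP.sum_eq ▸ max_le_posSum F f)

theorem IsEdgeRep.mem_iff_of_nonpos (hP : IsEdgeRep c P p E F) {r : V →L[ℝ] ℝ}
    (hr : r (c 0) = 1) (hrs : r E.sum = 0) {z : V} (hz : r (z - p) ≤ 0) :
    z ∈ P ↔ z - p ∈ zonotope F := by
  rw [hP.mem_iff, mem_zonotope_iff]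
  have side : 0 ≤ c.repr (z - p) 1 → c.repr (z - p) 1 ≤ c.repr E.sum 1 →
      ∀ f : V →L[ℝ] ℝ, 0 ≤ f (c 0) → f (z - p) ≤ max (f E.sum) 0 := fun h0 h1 f hf =>
    apply_le_max_of_side c h0 h1 (f' := -r) (by simpa [hrs] using hz) (by simpa using hz)
      (by simp [hr]) (by simp [hr, hf])
  constructor
  · intro h f
    rcases le_total 0 (f (c 0)) with hf | hf
    · obtain ⟨h0, h1⟩ := repr_le_of_apply_le hP.pos_left rfl fun f hf => (h f).2 hf.le
      rw [← hP.sum_eq] at h1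
      exact (side h0 h1 f hf).trans (hP.sum_eq ▸ max_le_posSum F f)
    · exact (h f).2 hf
  · intro h f
    refine ⟨fun hf => ?_, fun _ => h f⟩
    obtain ⟨h0, h1⟩ := repr_le_of_apply_le hP.pos_left rfl fun f _ => h f
    rw [← hP.sum_eq] at h1
    exact (side h0 h1 f hf).trans (max_le_posSum E f)

end EdgeRep

/-! ### Counting lattice points row by row. -/

section Counting

variable {V : Type*} [NormedAddCommGroup V] [NormedSpace ℝ V]

/-- Counting the lattice points of a set row by row. -/
theorem ncard_inter_span_eq_sum (B : Basis (Fin 2) ℝ V) {K : Set V} {m M : ℤ} {α β : ℤ → ℝ}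
    (hK : ∀ z ∈ K, m ≤ B.repr z 1 ∧ B.repr z 1 ≤ M)
    (hrow : ∀ j : ℤ, m ≤ j → j ≤ M → ∀ t : ℝ,
      t • B 0 + (j : ℝ) • B 1 ∈ K ↔ α j ≤ t ∧ t ≤ β j) :
    (K ∩ (span ℤ (Set.range B) : Set V)).ncard =
      ∑ j ∈ Finset.Icc m M, (Finset.Icc ⌈α j⌉ ⌊β j⌋).card := by
  classical
  let φ : (Σ _ : ℤ, ℤ) → V := fun a => (a.2 : ℝ) • B 0 + (a.1 : ℝ) • B 1
  have hφ : Function.Injective φ := by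
    rintro ⟨j, i⟩ ⟨j', i'⟩ h
    have h0 := congrArg (fun z => B.repr z 0) h
    have h1 := congrArg (fun z => B.repr z 1) h
    simp only [φ, (repr_pair B _ _).1] at h0
    simp only [φ, (repr_pair B _ _).2] at h1
    obtain rfl : i = i' := by exact_mod_cast h0
    obtain rfl : j = j' := by exact_mod_cast h1
    rfl
  have : K ∩ (span ℤ (Set.range B) : Set V) =
      φ '' ((Finset.Icc m M).sigma fun j => Finset.Icc ⌈α j⌉ ⌊β j⌋ : Finset (Σ _ : ℤ, ℤ)) := by
    ext z
    constructor
    · rintro ⟨hz, hzL⟩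
      obtain ⟨i, j, rfl⟩ := (mem_span_basis_iff B z).1 hzL
      have h1 := hK _ hz
      rw [(repr_pair B _ _).2] at h1
      have hm : m ≤ j := by exact_mod_cast h1.1
      have hM : j ≤ M := by exact_mod_cast h1.2
      refine ⟨⟨j, i⟩, ?_, rfl⟩
      have := (hrow j hm hM i).1 hz
      simp [hm, hM, Int.ceil_le, Int.le_floor, this.1, this.2]
    · rintro ⟨⟨j, i⟩, h, rfl⟩
      simp only [Finset.coe_sigma, Set.mem_sigma_iff, Finset.mem_coe, Finset.mem_Icc,
        Int.ceil_le, Int.le_floor] at h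
      exact ⟨(hrow j h.1.1 h.1.2 i).2 h.2, (mem_span_basis_iff B _).2 ⟨i, j, rfl⟩⟩
  rw [this, Set.ncard_image_of_injective _ hφ, Set.ncard_coe_finset, Finset.card_sigma]

/-- The row is compact and convex, and nonempty by connectedness of `K`, hence a closed interval. -/
theorem exists_row_eq_Icc (B : Basis (Fin 2) ℝ V) {K : Set V} (hK : Convex ℝ K)
    (hc : IsCompact K) {z₁ z₂ : V} (h₁ : z₁ ∈ K) (h₂ : z₂ ∈ K) {j : ℝ}
    (hj₁ : B.repr z₁ 1 ≤ j) (hj₂ : j ≤ B.repr z₂ 1) :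
    ∃ α β : ℝ, α ≤ β ∧ ∀ t : ℝ, t • B 0 + j • B 1 ∈ K ↔ α ≤ t ∧ t ≤ β := by
  have : FiniteDimensional ℝ V := B.finiteDimensional_of_finite
  let x : V →L[ℝ] ℝ := (B.coord 0).toContinuousLinearMap
  let y : V →L[ℝ] ℝ := (B.coord 1).toContinuousLinearMap
  have hx : ∀ z, x z = B.repr z 0 := fun z => rfl
  have hy : ∀ z, y z = B.repr z 1 := fun z => rfl
  set T : Set ℝ := x '' (K ∩ {z | y z = j}) with hT
  have hmem : ∀ t : ℝ, t • B 0 + j • B 1 ∈ K ↔ t ∈ T := by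
    intro t
    constructor
    · intro h
      exact ⟨_, ⟨h, by simp [hy]⟩, by simp [hx]⟩
    · rintro ⟨z, ⟨hz, hzj⟩, rfl⟩
      convert hz
      rw [← hzj, hx, hy]
      exact (eq_repr_pair B z).symm
  have hTconv : Convex ℝ T :=
    (hK.inter (convex_hyperplane y.isLinear j)).is_linear_image x.isLinear
  have hTcomp : IsCompact T :=
    (hc.inter_right (isClosed_eq y.continuous continuous_const)).image x.continuous
  have hTne : T.Nonempty := by
    have : Set.OrdConnected (y '' K) := (hK.is_linear_image y.isLinear).ordConnected
    obtain ⟨z, hz, hzj⟩ := this.out ⟨z₁, h₁, rfl⟩ ⟨z₂, h₂, rfl⟩ ⟨hj₁, hj₂⟩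
    exact ⟨x z, z, ⟨hz, hzj⟩, rfl⟩
  have hTeq := eq_Icc_of_connected_compact ⟨hTne, hTconv.isPreconnected⟩ hTcomp
  refine ⟨sInf T, sSup T, ?_, fun t => ?_⟩
  · rw [hTeq] at hTne
    exact Set.nonempty_Icc.1 hTne
  · rw [hmem, ← Set.mem_Icc, ← hTeq]

/-- Adding a lattice segment of lattice length `g` adds `g` lattice points in each lattice row
parallel to the segment that meets the set. -/
theorem ncard_add_segment (B : Basis (Fin 2) ℝ V) {K : Set V} (hK : Convex ℝ K)
    (hc : IsCompact K) {m : ℤ} {w : ℕ} {z₁ z₂ : V} (h₁ : z₁ ∈ K) (h₂ : z₂ ∈ K)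
    (hm : B.repr z₁ 1 = m) (hM : B.repr z₂ 1 = m + w)
    (hb : ∀ z ∈ K, m ≤ B.repr z 1 ∧ B.repr z 1 ≤ m + w) (g : ℕ) :
    ((K + segment ℝ 0 ((g : ℝ) • B 0)) ∩ (span ℤ (Set.range B) : Set V)).ncard =
      (K ∩ (span ℤ (Set.range B) : Set V)).ncard + g * (w + 1) := by
  have hrow : ∀ j : ℤ, ∃ α β : ℝ, m ≤ j → j ≤ m + w → α ≤ β ∧
      ∀ t : ℝ, t • B 0 + (j : ℝ) • B 1 ∈ K ↔ α ≤ t ∧ t ≤ β := by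
    intro j
    by_cases h : m ≤ j ∧ j ≤ m + w
    · obtain ⟨α, β, h'⟩ := exists_row_eq_Icc B hK hc h₁ h₂ (j := j)
        (by rw [hm]; exact_mod_cast h.1) (by rw [hM]; exact_mod_cast h.2)
      exact ⟨α, β, fun _ _ => h'⟩
    · exact ⟨0, 0, fun h1 h2 => absurd ⟨h1, h2⟩ h⟩
  choose α β hαβ using hrow
  have hseg : ∀ z, z ∈ K + segment ℝ 0 ((g : ℝ) • B 0) ↔
      ∃ s : ℝ, 0 ≤ s ∧ s ≤ g ∧ z - s • B 0 ∈ K := by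
    intro z
    constructor
    · rintro ⟨k, hk, _, hs, rfl⟩
      rw [segment_eq_image] at hs
      obtain ⟨s, hs, rfl⟩ := hs
      refine ⟨s * g, mul_nonneg hs.1 (Nat.cast_nonneg g),
        mul_le_of_le_one_left (Nat.cast_nonneg g) hs.2, ?_⟩
      simpa [smul_smul] using hk
    · rintro ⟨s, hs0, hsg, hk⟩
      refine ⟨_, hk, s • B 0, ?_, by simp⟩
      rw [segment_eq_image]
      rcases Nat.eq_zero_or_pos g with hg | hg
      · subst hg
        obtain rfl : s = 0 := le_antisymm (by simpa using hsg) hs0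
        exact ⟨0, by simp, by simp⟩
      · have hg' : (0 : ℝ) < g := by exact_mod_cast hg
        refine ⟨s / g, ⟨by positivity, (div_le_one hg').2 hsg⟩, ?_⟩
        simp [smul_smul, div_mul_cancel₀ s hg'.ne']
  have e1 := ncard_inter_span_eq_sum B (K := K) (m := m) (M := m + w) (α := α) (β := β)
    (by simpa using hb) (fun j h1 h2 => (hαβ j h1 h2).2)
  have e2 := ncard_inter_span_eq_sum B (K := K + segment ℝ 0 ((g : ℝ) • B 0)) (m := m)
    (M := m + w) (α := α) (β := fun j => β j + g) (by
      intro z hz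
      obtain ⟨s, -, -, hz⟩ := (hseg z).1 hz
      simpa using hb _ hz) (by
      intro j h1 h2 t
      obtain ⟨hle, hiff⟩ := hαβ j h1 h2
      rw [hseg]
      have : ∀ s : ℝ, t • B 0 + (j : ℝ) • B 1 - s • B 0 = (t - s) • B 0 + (j : ℝ) • B 1 := by
        intro s; module
      simp only [this, hiff]
      constructor
      · rintro ⟨s, hs0, hsg, h3, h4⟩
        constructor <;> linarith
      · rintro ⟨h3, h4⟩
        rcases le_total t (β j) with h | h
        · exact ⟨0, le_rfl, Nat.cast_nonneg g, by simpa using h3, by simpa using h⟩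
        · exact ⟨t - β j, by linarith, by linarith, by linarith, by linarith⟩)
  rw [e1, e2]
  have hcard : ∀ j ∈ Finset.Icc m (m + w), (Finset.Icc ⌈α j⌉ ⌊β j + g⌋).card =
      (Finset.Icc ⌈α j⌉ ⌊β j⌋).card + g := by
    intro j hj
    rw [Finset.mem_Icc] at hj
    have hle := (hαβ j hj.1 hj.2).1
    -- This prevents truncation in the cardinality of the integer interval, so a row without lattice
    -- points also gains exactly `g`.
    have : ⌈α j⌉ ≤ ⌊β j⌋ + 1 := by
      rw [Int.ceil_le]
      push_cast
      linarith [Int.lt_floor_add_one (β j)]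
    rw [Int.card_Icc, Int.card_Icc, Int.floor_add_natCast]
    omega
  rw [Finset.sum_congr rfl hcard, Finset.sum_add_distrib, Finset.sum_const, Int.card_Icc,
    smul_eq_mul]
  have : (m + w + 1 - m).toNat = w + 1 := by omega
  rw [this, mul_comm]

end Counting

/-! ### Zonotope counts and Pick's theorem. -/

section Pick

variable {V : Type*} [NormedAddCommGroup V] [NormedSpace ℝ V]

/-- Presents the lattice scaled by `1 / n` as one of the lattices containing the original. -/
theorem exists_basis_inv_smul (B : Basis (Fin 2) ℝ V) {n : ℕ} (hn : 0 < n) :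
    ∃ D : Basis (Fin 2) ℝ V, B 0 = (n : ℝ) • D 0 ∧ (∀ z, D.repr z 1 = n * B.repr z 1) ∧
      (span ℤ (Set.range D) : Set V) = (n : ℝ)⁻¹ • (span ℤ (Set.range B) : Set V) ∧
      span ℤ (Set.range B) ≤ span ℤ (Set.range D) := by
  have hn' : (n : ℝ) ≠ 0 := by exact_mod_cast hn.ne'
  obtain ⟨D, h0, h1⟩ := exists_basis_pair B (n : ℝ)⁻¹ 0 0 (n : ℝ)⁻¹ (by
    simp only [mul_zero, sub_zero]; positivity)
  rw [zero_smul, add_zero] at h0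
  rw [zero_smul, zero_add] at h1
  have hB0 : B 0 = (n : ℝ) • D 0 := by rw [h0, smul_inv_smul₀ hn']
  have hB1 : B 1 = (n : ℝ) • D 1 := by rw [h1, smul_inv_smul₀ hn']
  refine ⟨D, hB0, fun z => ?_, ?_, ?_⟩
  · conv_lhs => rw [eq_repr_pair B z, hB0, hB1, smul_smul, smul_smul]
    rw [(repr_pair D _ _).2, mul_comm]
  · ext z
    rw [Set.mem_smul_set_iff_inv_smul_mem₀ (inv_ne_zero hn'), inv_inv, SetLike.mem_coe,
      SetLike.mem_coe, mem_span_basis_iff, mem_span_basis_iff]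
    refine exists₂_congr fun i j => ?_
    rw [hB0, hB1, smul_comm (i : ℝ), smul_comm (j : ℝ), ← smul_add]
    exact (smul_right_injective V hn').eq_iff.symm
  · rw [span_le, Set.range_subset_iff, Fin.forall_fin_two]
    exact ⟨(mem_span_basis_iff D _).2 ⟨n, 0, by simp [hB0]⟩,
      (mem_span_basis_iff D _).2 ⟨0, n, by simp [hB1]⟩⟩

theorem posSum_eq_intCast {E : Multiset V} {f : V →L[ℝ] ℝ} (h : ∀ e ∈ E, ∃ k : ℤ, f e = k) :
    ∃ k : ℕ, posSum E f = k := by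
  induction E using Multiset.induction with
  | empty => exact ⟨0, by simp⟩
  | cons e E ih =>
    rw [Multiset.forall_mem_cons] at h
    obtain ⟨k, hk⟩ := ih h.2
    obtain ⟨l, hl⟩ := h.1
    refine ⟨l.toNat + k, ?_⟩
    rw [posSum_cons, hk, hl, Nat.cast_add]
    congr 1
    exact_mod_cast (Int.toNat_eq_max l).symm

/-- The number of points of the refined lattices in a zonotope. -/
theorem exists_ncard_zonotope_inter (b : Basis (Fin 2) ℝ V) {E : Multiset V}
    (hE : ∀ e ∈ E, e ∈ span ℤ (Set.range b)) :
    ∃ A : ℕ, ∀ n : ℕ, 0 < n →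
      (zonotope E ∩ (n : ℝ)⁻¹ • (span ℤ (Set.range b) : Set V)).ncard =
        1 + n * (E.map (latticeLength b)).sum + n ^ 2 * A := by
  induction E using Multiset.induction with
  | empty =>
    refine ⟨0, fun n hn => ?_⟩
    have : ({0} : Set V) ∩ (n : ℝ)⁻¹ • (span ℤ (Set.range b) : Set V) = {0} :=
      Set.inter_eq_left.2 (Set.singleton_subset_iff.2 ⟨0, zero_mem _, smul_zero _⟩)
    simp [this]
  | cons e E ih =>
    rw [Multiset.forall_mem_cons] at hE
    obtain ⟨A, hA⟩ := ih hE.2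
    obtain ⟨B, hB, heB⟩ := exists_basis_latticeLength_smul b hE.1
    have : FiniteDimensional ℝ V := B.finiteDimensional_of_finite
    let y : V →L[ℝ] ℝ := (B.coord 1).toContinuousLinearMap
    have hy : ∀ z, y z = B.repr z 1 := fun z => rfl
    have hint : ∀ e ∈ E, ∃ k : ℤ, y e = k := by
      intro e he
      obtain ⟨i, j, rfl⟩ := (mem_span_basis_iff B e).1 (hB ▸ hE.2 e he)
      exact ⟨j, by rw [hy, (repr_pair B _ _).2]⟩
    obtain ⟨k, hk⟩ := posSum_eq_intCast hint
    obtain ⟨l, hl⟩ := posSum_eq_intCast (f := -y) fun e he => by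
      obtain ⟨k, hk⟩ := hint e he
      exact ⟨-k, by simp [hk]⟩
    obtain ⟨⟨z₂, hz₂, hz₂k⟩, hub⟩ := isGreatest_image_zonotope E y
    obtain ⟨⟨z₁, hz₁, hz₁l⟩, hlb⟩ := isGreatest_image_zonotope E (-y)
    rw [hk, hy] at hz₂k
    rw [hl, neg_apply, hy] at hz₁l
    have hbd : ∀ z ∈ zonotope E, -(l : ℝ) ≤ B.repr z 1 ∧ B.repr z 1 ≤ k := by
      intro z hz
      have h1 := hub ⟨z, hz, rfl⟩
      have h2 := hlb ⟨z, hz, rfl⟩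
      rw [hk, hy] at h1
      rw [hl, neg_apply, hy] at h2
      exact ⟨by linarith, h1⟩
    -- Here `k + l` is the width of the zonotope across `e`. In the refined lattice the segment has
    -- length `n * latticeLength b e` and meets `n * (k + l) + 1` rows.
    refine ⟨A + latticeLength b e * (k + l), fun n hn => ?_⟩
    have hn0 : (0 : ℝ) ≤ n := Nat.cast_nonneg n
    obtain ⟨D, hD0, hD1, hDs, -⟩ := exists_basis_inv_smul B hn
    have heD : e = ((latticeLength b e * n : ℕ) : ℝ) • D 0 :=
      heB.trans (by rw [hD0, smul_smul, Nat.cast_mul])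
    have key := ncard_add_segment D (convex_zonotope E) (isCompact_zonotope E)
      (m := -(n * l : ℕ)) (w := n * (k + l)) hz₁ hz₂
      (by rw [hD1]; push_cast; linear_combination -(n : ℝ) * hz₁l)
      (by rw [hD1]; push_cast; linear_combination (n : ℝ) * hz₂k)
      (fun z hz => by
        have h1 := mul_le_mul_of_nonneg_left (hbd z hz).1 hn0
        have h2 := mul_le_mul_of_nonneg_left (hbd z hz).2 hn0
        rw [hD1]; push_cast
        constructor <;> linarith)
      (latticeLength b e * n)
    rw [← heD, ← zonotope_cons, hDs, hB, hA n hn] at key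
    rw [key, Multiset.map_cons, Multiset.sum_cons]
    ring

variable {c : Basis (Fin 2) ℝ V} {P : Set V} {p : V} {E F : Multiset V}

theorem ncard_eq_add_add {α : Type*} {A : Set α} (hA : A.Finite) (r : α → ℝ) :
    A.ncard = (A ∩ {z | 0 < r z}).ncard + (A ∩ {z | r z = 0}).ncard +
      (A ∩ {z | r z < 0}).ncard := by
  rw [← Set.ncard_union_eq _ (hA.inter_of_left _) (hA.inter_of_left _),
    ← Set.ncard_union_eq _ ((hA.inter_of_left _).union (hA.inter_of_left _)) (hA.inter_of_left _)]
  · congr 1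
    ext z
    have := lt_trichotomy 0 (r z)
    simp only [Set.mem_union, Set.mem_inter_iff, Set.mem_ofPred_eq, eq_comm (a := r z)]
    tauto
  · rw [Set.disjoint_left]
    rintro z (⟨-, h⟩ | ⟨-, h⟩) ⟨-, h'⟩ <;> simp only [Set.mem_ofPred_eq] at h h' <;> linarith
  · rw [Set.disjoint_left]
    rintro z ⟨-, h⟩ ⟨-, h'⟩
    simp only [Set.mem_ofPred_eq] at h h'
    linarith

/-- The symmetry `z ↦ E.sum - z` preserves the lattice and exchanges the two sides of the diagonal.
-/
theorem ncard_zonotope_inter_eq {L : Submodule ℤ V} (hs : E.sum ∈ L)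
    {r : V →L[ℝ] ℝ} (hr : r E.sum = 0) :
    (zonotope E ∩ (L : Set V) ∩ {z | 0 < r z}).ncard =
      (zonotope E ∩ (L : Set V) ∩ {z | r z < 0}).ncard := by
  have : (fun z => E.sum - z) '' (zonotope E ∩ (L : Set V) ∩ {z | 0 < r z}) =
      zonotope E ∩ (L : Set V) ∩ {z | r z < 0} := by
    ext z
    constructor
    · rintro ⟨w, ⟨⟨h1, h2⟩, h3⟩, rfl⟩
      refine ⟨⟨sum_sub_mem_zonotope h1, L.sub_mem hs h2⟩, ?_⟩
      simpa [hr] using h3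
    · rintro ⟨⟨h1, h2⟩, h3⟩
      refine ⟨E.sum - z, ⟨⟨sum_sub_mem_zonotope h1, L.sub_mem hs h2⟩, ?_⟩, by simp⟩
      simpa [hr] using h3
  rw [← this, Set.ncard_image_of_injective _ sub_right_injective]

/-- A polygon has as many lattice points as, on average, the two zonotopes generated by its right
edges and by its left edges. -/
theorem IsEdgeRep.two_mul_ncard_inter (hP : IsEdgeRep c P p E F) {L : Submodule ℤ V}
    (hp : p ∈ L) (hs : E.sum ∈ L) (hfin : ∀ K : Set V, IsCompact K → (K ∩ (L : Set V)).Finite) :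
    2 * (P ∩ (L : Set V)).ncard =
      (zonotope E ∩ (L : Set V)).ncard + (zonotope F ∩ (L : Set V)).ncard := by
  have : FiniteDimensional ℝ V := c.finiteDimensional_of_finite
  obtain ⟨r, hr0, hrs⟩ : ∃ r : V →L[ℝ] ℝ, r (c 0) = 1 ∧ r E.sum = 0 := by
    let y : V →L[ℝ] ℝ := (c.coord 1).toContinuousLinearMap
    let x : V →L[ℝ] ℝ := (c.coord 0).toContinuousLinearMap
    have hy : ∀ z, y z = c.repr z 1 := fun z => rfl
    have hx : ∀ z, x z = c.repr z 0 := fun z => rfl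
    -- The horizontal coordinate, sheared to vanish on the diagonal. A diagonal of height 0 occurs
    -- only for a single point, where `E.sum = 0`.
    refine ⟨x - (x E.sum / y E.sum) • y, by simp [hx, hy], ?_⟩
    by_cases h : y E.sum = 0
    · have hE : E = 0 := by
        by_contra hE
        obtain ⟨e, he⟩ := Multiset.exists_mem_of_ne_zero hE
        obtain ⟨E', rfl⟩ := Multiset.exists_cons_of_mem he
        have h1 := hP.pos_right e he
        have h2 := repr_sum_nonneg (c := c) (E := E') fun e he =>
          hP.pos_right e (Multiset.mem_cons_of_mem he)
        rw [hy, Multiset.sum_cons, map_add, Finsupp.add_apply] at h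
        linarith
      simp [hE]
    · simp only [sub_apply, smul_apply, smul_eq_mul]
      field_simp
      ring
  set P' : Set V := {z | z + p ∈ P} with hP'
  have hcard : (P ∩ (L : Set V)).ncard = (P' ∩ (L : Set V)).ncard := by
    have : (fun z => z + p) '' (P' ∩ (L : Set V)) = P ∩ (L : Set V) := by
      ext z
      constructor
      · rintro ⟨w, ⟨h1, h2⟩, rfl⟩
        exact ⟨h1, L.add_mem h2 hp⟩
      · rintro ⟨h1, h2⟩
        exact ⟨z - p, ⟨by simpa [hP'] using h1, L.sub_mem h2 hp⟩, by simp⟩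
    rw [← this, Set.ncard_image_of_injective _ (add_left_injective p)]
  have hfin' : (P' ∩ (L : Set V)).Finite := by
    refine Set.Finite.subset ((hfin P hP.isCompact).image fun z => z - p) ?_
    rintro z ⟨h1, h2⟩
    exact ⟨z + p, ⟨h1, L.add_mem h2 hp⟩, by simp⟩
  have hright : ∀ z, 0 ≤ r z → (z ∈ P' ↔ z ∈ zonotope E) := fun z hz => by
    simpa [hP'] using hP.mem_iff_of_nonneg hr0 hrs (z := z + p) (by simpa using hz)
  have hleft : ∀ z, r z ≤ 0 → (z ∈ P' ↔ z ∈ zonotope F) := fun z hz => by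
    simpa [hP'] using hP.mem_iff_of_nonpos hr0 hrs (z := z + p) (by simpa using hz)
  have hEfin := hfin _ (isCompact_zonotope E)
  have hFfin := hfin _ (isCompact_zonotope F)
  have e1 : P' ∩ (L : Set V) ∩ {z | 0 < r z} = zonotope E ∩ (L : Set V) ∩ {z | 0 < r z} := by
    ext z
    simp only [Set.mem_inter_iff, Set.mem_ofPred_eq, and_congr_left_iff]
    exact fun h _ => hright z h.le
  have e2 : P' ∩ (L : Set V) ∩ {z | r z = 0} = zonotope E ∩ (L : Set V) ∩ {z | r z = 0} := by
    ext z
    simp only [Set.mem_inter_iff, Set.mem_ofPred_eq, and_congr_left_iff]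
    exact fun h _ => hright z h.ge
  have e3 : P' ∩ (L : Set V) ∩ {z | r z = 0} = zonotope F ∩ (L : Set V) ∩ {z | r z = 0} := by
    ext z
    simp only [Set.mem_inter_iff, Set.mem_ofPred_eq, and_congr_left_iff]
    exact fun h _ => hleft z h.le
  have e4 : P' ∩ (L : Set V) ∩ {z | r z < 0} = zonotope F ∩ (L : Set V) ∩ {z | r z < 0} := by
    ext z
    simp only [Set.mem_inter_iff, Set.mem_ofPred_eq, and_congr_left_iff]
    exact fun h _ => hleft z h.le
  have s1 := ncard_zonotope_inter_eq hs hrs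
  have s2 := ncard_zonotope_inter_eq (hP.sum_eq ▸ hs) (r := r) (hP.sum_eq ▸ hrs)
  -- Each zonotope contributes twice its half of the polygon, plus the points of the diagonal, which
  -- both contain.
  rw [hcard, ncard_eq_add_add hfin' r, ncard_eq_add_add hEfin r, ncard_eq_add_add hFfin r, s2,
    ← s1, ← e1, ← e2, ← e3, ← e4]
  ring

theorem finite_inter_span_basis (b : Basis (Fin 2) ℝ V) {K : Set V} (hK : IsCompact K) :
    (K ∩ (span ℤ (Set.range b) : Set V)).Finite := by
  have : FiniteDimensional ℝ V := b.finiteDimensional_of_finite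
  have : ProperSpace V := FiniteDimensional.proper ℝ V
  exact ZSpan.setFinite_inter b hK.isBounded

/-- The boundary of a convex set is a null set, so counting points of finer lattices computes the
area. -/
theorem tendsto_ncard_inter_div_sq [MeasurableSpace V] [BorelSpace V] (b : Basis (Fin 2) ℝ V)
    (hP : Convex ℝ P) (hc : IsCompact P) :
    Filter.Tendsto (fun n : ℕ =>
        ((P ∩ (n : ℝ)⁻¹ • (span ℤ (Set.range b) : Set V)).ncard : ℝ) / (n : ℝ) ^ 2)
      Filter.atTop (nhds (MeasureTheory.volume.real (b.equivFun '' P))) := by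
  have : FiniteDimensional ℝ V := b.finiteDimensional_of_finite
  have hb : (b.restrictScalars ℤ).ofZLatticeBasis ℝ (span ℤ (Set.range b)) = b := by
    apply Basis.eq_of_apply_eq
    intro i
    rw [Basis.ofZLatticeBasis_apply, Basis.restrictScalars_apply]
  have := ZLattice.covolume.tendsto_card_div_pow'' (b.restrictScalars ℤ) hc.isBounded
    hc.measurableSet (by
      rw [hb]
      apply Convex.addHaar_frontier
      exact hP.is_linear_image b.equivFun.toLinearMap.isLinear)
  rw [hb] at this
  simpa only [Nat.card_coe_set_eq, Fintype.card_fin] using this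

/-- **Pick's theorem** for lattice polygons, including degenerate ones. -/
theorem IsEdgeRep.ncard_inter_eq [MeasurableSpace V] [BorelSpace V] (hP : IsEdgeRep c P p E F)
    (b : Basis (Fin 2) ℝ V) (hp : p ∈ span ℤ (Set.range b))
    (hE : ∀ e ∈ E, e ∈ span ℤ (Set.range b)) (hF : ∀ e ∈ F, e ∈ span ℤ (Set.range b)) :
    ((P ∩ (span ℤ (Set.range b) : Set V)).ncard : ℝ) =
      1 + (((E + F).map (latticeLength b)).sum : ℕ) / 2 +
        MeasureTheory.volume.real (b.equivFun '' P) := by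
  obtain ⟨A₁, hA₁⟩ := exists_ncard_zonotope_inter b hE
  obtain ⟨A₂, hA₂⟩ := exists_ncard_zonotope_inter b hF
  set ℓ := ((E + F).map (latticeLength b)).sum with hℓ
  -- The count is a quadratic polynomial in `n`. Its leading coefficient is the area, by the limit
  -- as `n` grows, and `n = 1` gives the formula.
  have key : ∀ n : ℕ, 0 < n →
      ((P ∩ (n : ℝ)⁻¹ • (span ℤ (Set.range b) : Set V)).ncard : ℝ) =
        1 + n * (ℓ / 2) + n ^ 2 * ((A₁ + A₂) / 2) := by
    intro n hn
    obtain ⟨D, -, -, hDs, hle⟩ := exists_basis_inv_smul b hn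
    have h := hP.two_mul_ncard_inter (hle hp) (hle (multiset_sum_mem _ hE))
      fun K hK => finite_inter_span_basis D hK
    rw [hDs, hA₁ n hn, hA₂ n hn] at h
    rw [hℓ, Multiset.map_add, Multiset.sum_add]
    have h' := congrArg (Nat.cast : ℕ → ℝ) h
    push_cast at h' ⊢
    linarith
  have hlim : Filter.Tendsto (fun n : ℕ =>
      ((P ∩ (n : ℝ)⁻¹ • (span ℤ (Set.range b) : Set V)).ncard : ℝ) / (n : ℝ) ^ 2)
      Filter.atTop (nhds (((A₁ : ℝ) + A₂) / 2)) := by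
    have h1 : Filter.Tendsto (fun n : ℕ => (n : ℝ)⁻¹ ^ 2 + (n : ℝ)⁻¹ * (ℓ / 2) +
        ((A₁ : ℝ) + A₂) / 2) Filter.atTop (nhds (0 ^ 2 + 0 * (ℓ / 2) + ((A₁ : ℝ) + A₂) / 2)) :=
      ((tendsto_inv_atTop_nhds_zero_nat.pow 2).add
        (tendsto_inv_atTop_nhds_zero_nat.mul_const _)).add_const _
    rw [show (0 : ℝ) ^ 2 + 0 * (ℓ / 2) + ((A₁ : ℝ) + A₂) / 2 = ((A₁ : ℝ) + A₂) / 2 by ring] at h1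
    refine h1.congr' ?_
    filter_upwards [Filter.eventually_gt_atTop 0] with n hn
    have hn' : (n : ℝ) ≠ 0 := by exact_mod_cast hn.ne'
    rw [key n hn]
    field_simp
  rw [tendsto_nhds_unique (tendsto_ncard_inter_div_sq b hP.convex hP.isCompact) hlim]
  have := key 1 one_pos
  simpa using this

end Pick

/-! ### Recovering area and edges from the counts, and the decomposition. -/

section Main

variable {V : Type*} [NormedAddCommGroup V] [NormedSpace ℝ V]

theorem IsLattice.exists_basis (hV : finrank ℝ V = 2) {L : Submodule ℤ V} (hL : IsLattice L) :
    ∃ b : Basis (Fin 2) ℝ V, span ℤ (Set.range b) = L := by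
  have : FiniteDimensional ℝ V := FiniteDimensional.of_finrank_pos (by omega)
  have : ProperSpace V := FiniteDimensional.proper ℝ V
  obtain ⟨_, _⟩ := hL
  have : Module.Free ℤ L := ZLattice.module_free ℝ L
  have : Module.Finite ℤ L := ZLattice.module_finite ℝ L
  have hr : finrank ℤ L = 2 := by rw [ZLattice.rank ℝ L, hV]
  let b := Module.finBasisOfFinrankEq ℤ L hr
  exact ⟨b.ofZLatticeBasis ℝ L, b.ofZLatticeBasis_span ℝ L⟩

theorem isLattice_span_basis (b : Basis (Fin 2) ℝ V) : IsLattice (span ℤ (Set.range b)) := by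
  have : FiniteDimensional ℝ V := b.finiteDimensional_of_finite
  exact ⟨inferInstance, inferInstance⟩

theorem IsLatticePolytope.isCompact {L : Submodule ℤ V} {P : Set V} (hP : IsLatticePolytope L P) :
    IsCompact P := by
  obtain ⟨S, -, -, rfl⟩ := hP
  exact S.finite_toSet.isCompact_convexHull ℝ

theorem IsLatticePolytope.convex {L : Submodule ℤ V} {P : Set V} (hP : IsLatticePolytope L P) :
    Convex ℝ P := by
  obtain ⟨S, -, -, rfl⟩ := hP
  exact convex_convexHull ℝ _

/-- Uniqueness of Haar measure: Pick's formula uses the area normalised by the lattice basis, a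
fixed multiple of any other. -/
theorem exists_volume_image_equivFun_eq [MeasurableSpace V] [BorelSpace V]
    (area : MeasureTheory.Measure V) [area.IsAddHaarMeasure] (b : Basis (Fin 2) ℝ V) :
    ∃ k : ℝ, k ≠ 0 ∧ ∀ P : Set V,
      MeasureTheory.volume.real (b.equivFun '' P) = k * area.real P := by
  have : FiniteDimensional ℝ V := b.finiteDimensional_of_finite
  let e := b.equivFun.toContinuousLinearEquiv
  let μ : MeasureTheory.Measure V :=
    (MeasureTheory.volume : MeasureTheory.Measure (Fin 2 → ℝ)).map e.symm
  have hμ : μ.IsAddHaarMeasure := e.symm.isAddHaarMeasure_map _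
  refine ⟨MeasureTheory.Measure.addHaarScalarFactor μ area, ?_, fun P => ?_⟩
  · exact_mod_cast (MeasureTheory.Measure.addHaarScalarFactor_pos_of_isAddHaarMeasure μ area).ne'
  · have h1 : MeasureTheory.volume (b.equivFun '' P) = μ P := by
      have : μ P = MeasureTheory.volume (e.symm ⁻¹' P) :=
        e.symm.toHomeomorph.toMeasurableEquiv.map_apply P
      rw [this]
      congr 1
      exact b.equivFun.toEquiv.image_eq_preimage_symm P
    have h2 := congrArg (fun ν => ν P)
      (MeasureTheory.Measure.isAddLeftInvariant_eq_smul μ area)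
    rw [MeasureTheory.measureReal_def, h1, h2, MeasureTheory.measureReal_def]
    simp

theorem IsEdgeRep.vadd {c : Basis (Fin 2) ℝ V} {P : Set V} {p : V} {E F : Multiset V}
    (hP : IsEdgeRep c P p E F) (v : V) : IsEdgeRep c (v +ᵥ P) (v + p) E F := by
  have hv : IsEdgeRep c {v} v 0 0 :=
    { convex := convex_singleton v
      isCompact := isCompact_singleton
      pos_right := by simp
      pos_left := by simp
      sum_eq := rfl
      right := by simp
      left := by simp }
  have := hv.add hP
  rwa [zero_add, zero_add, ← vadd_eq_add {v} P, Set.singleton_vadd] at this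

/-- Refining a lattice in the direction of one primitive vector changes the lattice length of
this vector only. -/
theorem exists_basis_latticeLength_eq (b : Basis (Fin 2) ℝ V) {u : V}
    (hu : IsPrimitive (span ℤ (Set.range b)) u) (G : Multiset V)
    (hG : ∀ v ∈ G, IsPrimitive (span ℤ (Set.range b)) v ∧ v ≠ -u) :
    ∃ (D : Basis (Fin 2) ℝ V) (n : ℕ), 0 < n ∧ span ℤ (Set.range b) ≤ span ℤ (Set.range D) ∧
      ∀ v ∈ G, latticeLength D v = 1 + Set.indicator {u} (fun _ => n) v := by
  obtain ⟨B, hB, huB⟩ := exists_basis_latticeLength_smul b hu.1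
  rw [hu.latticeLength_eq, Nat.cast_one, one_smul] at huB
  rw [← hB] at hG ⊢
  -- A prime exceeding every `B 1`-coordinate in `G` is coprime to the nonzero ones, so dividing `B
  -- 0` by it leaves those vectors primitive.
  obtain ⟨n, hn, hnp⟩ :=
    Nat.exists_infinite_primes ((G.map fun v => ⌊B.repr v 1⌋.natAbs).sum + 1)
  have hn0 : (n : ℝ) ≠ 0 := by exact_mod_cast hnp.ne_zero
  obtain ⟨D, hD0, hD1⟩ := exists_basis_pair B (n : ℝ)⁻¹ 0 0 1 (by
    simpa using hnp.ne_zero)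
  rw [zero_smul, add_zero] at hD0
  rw [zero_smul, zero_add, one_smul] at hD1
  have hpair : ∀ i j : ℤ, (i : ℝ) • B 0 + (j : ℝ) • B 1 =
      ((n * i : ℤ) : ℝ) • D 0 + (j : ℝ) • D 1 := by
    intro i j
    rw [hD0, hD1, smul_smul]
    congr 2
    push_cast
    field_simp
  -- The length of `u` grows from 1 to the prime `n`, an increase of `n - 1`.
  refine ⟨D, n - 1, Nat.sub_pos_of_lt hnp.one_lt, ?_, ?_⟩
  · intro z hz
    obtain ⟨i, j, rfl⟩ := (mem_span_basis_iff B z).1 hz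
    exact (mem_span_basis_iff D _).2 ⟨_, _, hpair i j⟩
  intro v hv
  obtain ⟨hvp, hvu⟩ := hG v hv
  obtain ⟨i, j, hij⟩ := (mem_span_basis_iff B v).1 hvp.1
  have hlen := hvp.latticeLength_eq
  have hjn : j.natAbs < n := by
    have h1 := Multiset.le_sum_of_mem (Multiset.mem_map_of_mem (fun v => ⌊B.repr v 1⌋.natAbs) hv)
    rw [hij, (repr_pair B _ _).2, Int.floor_intCast] at h1
    omega
  rw [hij, latticeLength_pair] at hlen
  rw [hij, hpair, latticeLength_pair, ← hpair, ← hij]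
  by_cases hj : j = 0
  · subst hj
    rw [Int.gcd_zero_right] at hlen
    have hvu' : v = u := by
      rcases Int.natAbs_eq i with h | h
      · rw [hij, h, hlen, huB]; simp
      · exact absurd (by rw [hij, h, hlen, huB]; simp) hvu
    have : 1 ≤ n := hnp.one_lt.le
    rw [hvu', Set.indicator_of_mem (Set.mem_singleton u), Int.gcd_zero_right, Int.natAbs_mul, hlen]
    simp
    omega
  · have hvu' : v ∉ ({u} : Set V) := by
      rw [Set.mem_singleton_iff]
      intro h
      have h1 := congrArg (fun z => B.repr z 1) (hij.symm.trans (h.trans huB))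
      simp only [(repr_pair B _ _).2] at h1
      simp at h1
      exact hj h1
    rw [Set.indicator_of_notMem hvu', add_zero, ← Int.isCoprime_iff_gcd_eq_one]
    refine IsCoprime.mul_left ?_ (Int.isCoprime_iff_gcd_eq_one.2 hlen)
    rw [Int.isCoprime_iff_gcd_eq_one, Int.gcd_def, Int.natAbs_natCast]
    exact (Nat.coprime_of_lt_prime (Int.natAbs_ne_zero.2 hj) hjn hnp).gcd_eq_one

theorem sum_map_one_add_indicator {α : Type*} [DecidableEq α] {G : Multiset α} {u : α} {n : ℕ}
    {ℓ : α → ℕ}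
    (h : ∀ v ∈ G, ℓ v = 1 + Set.indicator {u} (fun _ => n) v) :
    (G.map ℓ).sum = G.card + n * G.count u := by
  induction G using Multiset.induction with
  | empty => simp
  | cons v G ih =>
    rw [Multiset.forall_mem_cons] at h
    rw [Multiset.map_cons, Multiset.sum_cons, ih h.2, h.1, Multiset.card_cons,
      Multiset.count_cons]
    by_cases hv : v = u
    · simp [hv]; ring
    · rw [Set.indicator_of_notMem (by simpa using hv), if_neg (Ne.symm hv)]; ring

/-- The primitive edges of a polygon, up to sign, are determined by its lattice perimeter in all
lattices that contain the given one. -/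
theorem eq_of_sum_latticeLength_eq (b c : Basis (Fin 2) ℝ V) {G G' : Multiset V}
    (hG : ∀ v ∈ G, IsPrimitive (span ℤ (Set.range b)) v ∧ 0 < c.repr v 1)
    (hG' : ∀ v ∈ G', IsPrimitive (span ℤ (Set.range b)) v ∧ 0 < c.repr v 1)
    (h : ∀ D : Basis (Fin 2) ℝ V, span ℤ (Set.range b) ≤ span ℤ (Set.range D) →
      (G.map (latticeLength D)).sum = (G'.map (latticeLength D)).sum) : G = G' := by
  classical
  have hcard : ∀ G : Multiset V, (∀ v ∈ G, IsPrimitive (span ℤ (Set.range b)) v ∧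
      0 < c.repr v 1) → (G.map (latticeLength b)).sum = G.card := by
    intro G hG
    rw [Multiset.map_congr rfl fun v hv => (hG v hv).1.latticeLength_eq]
    simp
  have hGG := h b le_rfl
  rw [hcard G hG, hcard G' hG'] at hGG
  have hsum : ∀ v ∈ G + G', IsPrimitive (span ℤ (Set.range b)) v ∧ 0 < c.repr v 1 := fun v hv =>
    (Multiset.mem_add.1 hv).elim (hG v) (hG' v)
  ext u
  by_cases hu : u ∈ G + G'
  · obtain ⟨hup, huc⟩ := hsum u hu
    obtain ⟨D, n, hn, hD, hlen⟩ := exists_basis_latticeLength_eq b hup (G + G') fun v hv => by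
      refine ⟨(hsum v hv).1, ?_⟩
      -- `u` and `-u` cannot both point upwards.
      rintro rfl
      have := (hsum _ hv).2
      simp only [map_neg, Finsupp.neg_apply] at this
      linarith
    have := h D hD
    rw [sum_map_one_add_indicator fun v hv => hlen v (Multiset.mem_add.2 (Or.inl hv)),
      sum_map_one_add_indicator fun v hv => hlen v (Multiset.mem_add.2 (Or.inr hv)), hGG] at this
    exact Nat.eq_of_mul_eq_mul_left hn (Nat.add_left_cancel this)
  · rw [Multiset.mem_add, not_or] at hu
    rw [Multiset.count_eq_zero.2 hu.1, Multiset.count_eq_zero.2 hu.2]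

/-- Both areas are limits of the same normalised counts in the lattices scaled by `1 / n`. -/
theorem measure_eq_of_ncard_eq [MeasurableSpace V] [BorelSpace V]
    (area : MeasureTheory.Measure V) [area.IsAddHaarMeasure] (b : Basis (Fin 2) ℝ V)
    {P Q : Set V} (hP : Convex ℝ P) (hPc : IsCompact P) (hQ : Convex ℝ Q) (hQc : IsCompact Q)
    (h : ∀ D : Basis (Fin 2) ℝ V, span ℤ (Set.range b) ≤ span ℤ (Set.range D) →
      (P ∩ (span ℤ (Set.range D) : Set V)).ncard = (Q ∩ (span ℤ (Set.range D) : Set V)).ncard) :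
    area P = area Q := by
  have hlim := tendsto_ncard_inter_div_sq b hP hPc
  have hlim' := tendsto_ncard_inter_div_sq b hQ hQc
  replace hlim := hlim.congr' (f₂ := fun n : ℕ =>
      ((Q ∩ (n : ℝ)⁻¹ • (span ℤ (Set.range b) : Set V)).ncard : ℝ) / (n : ℝ) ^ 2) (by
    filter_upwards [Filter.eventually_gt_atTop 0] with n hn
    obtain ⟨D, -, -, hDs, hle⟩ := exists_basis_inv_smul b hn
    rw [← hDs, h D hle])
  obtain ⟨k, hk, hvol⟩ := exists_volume_image_equivFun_eq area b
  have := tendsto_nhds_unique hlim hlim'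
  rw [hvol, hvol] at this
  exact (ENNReal.toReal_eq_toReal_iff' hPc.measure_lt_top.ne hQc.measure_lt_top.ne).1
    (mul_left_cancel₀ hk this)

/-- Negating `Y` only swaps its chains, so `P` and `Q` have the same edges in total; Pick's formula
does the rest. -/
theorem ncard_eq_of_minkowski [MeasurableSpace V] [BorelSpace V]
    (area : MeasureTheory.Measure V) [area.IsAddHaarMeasure] {b : Basis (Fin 2) ℝ V}
    {P Q X Y : Set V} (hX : IsLatticePolytope (span ℤ (Set.range b)) X)
    (hY : IsLatticePolytope (span ℤ (Set.range b)) Y)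
    (hPX : IsLatticeTranslate (span ℤ (Set.range b)) P (X + Y))
    (hQX : IsLatticeTranslate (span ℤ (Set.range b)) Q (X - Y)) (harea : area P = area Q)
    (D : Basis (Fin 2) ℝ V) (hD : span ℤ (Set.range b) ≤ span ℤ (Set.range D)) :
    (P ∩ (span ℤ (Set.range D) : Set V)).ncard =
      (Q ∩ (span ℤ (Set.range D) : Set V)).ncard := by
  obtain ⟨c, hc⟩ := exists_basis_injOn b
  obtain ⟨x, hx, E, F, hE, hF, hXr⟩ := hX.exists_isEdgeRep c hc fun e => exists_primitive_smul b
  obtain ⟨y, hy, E', F', hE', hF', hYr⟩ := hY.exists_isEdgeRep c hc fun e => exists_primitive_smul b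
  obtain ⟨v, hv, hPv⟩ := hPX
  obtain ⟨w, hw, hQw⟩ := hQX
  have hPr := (hXr.add hYr).vadd v
  have hQr := (hXr.add hYr.neg).vadd w
  rw [← hPv] at hPr
  rw [← sub_eq_add_neg, ← hQw] at hQr
  have hmem : ∀ {E F : Multiset V}, (∀ e ∈ E, IsPrimitive (span ℤ (Set.range b)) e) →
      (∀ e ∈ F, IsPrimitive (span ℤ (Set.range b)) e) →
      ∀ e ∈ E + F, e ∈ span ℤ (Set.range D) := fun hE hF e he =>
    hD ((Multiset.mem_add.1 he).elim (fun h => (hE e h).1) fun h => (hF e h).1)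
  have hs : E'.sum ∈ span ℤ (Set.range b) := multiset_sum_mem _ fun e he => (hE' e he).1
  have e1 := hPr.ncard_inter_eq D (hD (add_mem hv (add_mem hx hy))) (hmem hE hE') (hmem hF hF')
  have e2 := hQr.ncard_inter_eq D (hD (add_mem hw (add_mem hx (neg_mem (add_mem hy hs)))))
    (hmem hE hF') (hmem hF hE')
  obtain ⟨k, -, hvol⟩ := exists_volume_image_equivFun_eq area D
  rw [hvol] at e1 e2
  have hEF : E + F' + (F + E') = E + E' + (F + F') := by abel
  rw [hEF, MeasureTheory.measureReal_def, ← harea, ← MeasureTheory.measureReal_def, ← e1] at e2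
  exact_mod_cast e2.symm

theorem exists_minkowski_of_ncard_eq [MeasurableSpace V] [BorelSpace V]
    (area : MeasureTheory.Measure V) [area.IsAddHaarMeasure] {b : Basis (Fin 2) ℝ V}
    {P Q : Set V} (hP : IsLatticePolytope (span ℤ (Set.range b)) P)
    (hQ : IsLatticePolytope (span ℤ (Set.range b)) Q)
    (h : ∀ D : Basis (Fin 2) ℝ V, span ℤ (Set.range b) ≤ span ℤ (Set.range D) →
      (P ∩ (span ℤ (Set.range D) : Set V)).ncard = (Q ∩ (span ℤ (Set.range D) : Set V)).ncard)
    (harea : area P = area Q) :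
    ∃ X Y : Set V, IsLatticePolytope (span ℤ (Set.range b)) X ∧
      IsLatticePolytope (span ℤ (Set.range b)) Y ∧
      IsLatticeTranslate (span ℤ (Set.range b)) P (X + Y) ∧
      IsLatticeTranslate (span ℤ (Set.range b)) Q (X - Y) := by
  classical
  obtain ⟨c, hc⟩ := exists_basis_injOn b
  obtain ⟨p, hp, E, F, hE, hF, hPr⟩ := hP.exists_isEdgeRep c hc fun e => exists_primitive_smul b
  obtain ⟨q, hq, E', F', hE', hF', hQr⟩ := hQ.exists_isEdgeRep c hc fun e => exists_primitive_smul b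
  -- With equal counts and areas, Pick's formula leaves equal lattice perimeters in every larger
  -- lattice.
  have hEF : E + F = E' + F' := by
    refine eq_of_sum_latticeLength_eq b c ?_ ?_ fun D hD => ?_
    · exact fun v hv => (Multiset.mem_add.1 hv).elim (fun h => ⟨hE v h, hPr.pos_right v h⟩)
        fun h => ⟨hF v h, hPr.pos_left v h⟩
    · exact fun v hv => (Multiset.mem_add.1 hv).elim (fun h => ⟨hE' v h, hQr.pos_right v h⟩)
        fun h => ⟨hF' v h, hQr.pos_left v h⟩
    · have e1 := hPr.ncard_inter_eq D (hD hp) (fun e he => hD (hE e he).1)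
        fun e he => hD (hF e he).1
      have e2 := hQr.ncard_inter_eq D (hD hq) (fun e he => hD (hE' e he).1)
        fun e he => hD (hF' e he).1
      obtain ⟨k, -, hvol⟩ := exists_volume_image_equivFun_eq area D
      rw [hvol] at e1 e2
      rw [h D hD, MeasureTheory.measureReal_def, harea, ← MeasureTheory.measureReal_def, e2] at e1
      have : (((E + F).map (latticeLength D)).sum : ℝ) =
        ((E' + F').map (latticeLength D)).sum := by linarith
      exact_mod_cast this
  have hcount : ∀ v, E.count v + F.count v = E'.count v + F'.count v := fun v => by
    rw [← Multiset.count_add, ← Multiset.count_add, hEF]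
  have h1 : E ∩ E' + (E - E') = E := by
    ext v; rw [Multiset.count_add, Multiset.count_inter, Multiset.count_sub]; omega
  have h2 : F ∩ F' + (F - F') = F := by
    ext v; rw [Multiset.count_add, Multiset.count_inter, Multiset.count_sub]; omega
  -- By `hcount`, what `P` has in excess on the left is what `Q` has in excess on the right.
  have h3 : E ∩ E' + (F - F') = E' := by
    ext v; have := hcount v
    rw [Multiset.count_add, Multiset.count_inter, Multiset.count_sub]; omega
  have h4 : F ∩ F' + (E - E') = F' := by
    ext v; have := hcount v
    rw [Multiset.count_add, Multiset.count_inter, Multiset.count_sub]; omega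
  -- Each diagonal is half the sum of all edges, so the two diagonals agree. This gives the closing
  -- conditions `hsX` and `hsY` for the chains of `X` and `Y`.
  have hss : E.sum = E'.sum := by
    have := congrArg Multiset.sum hEF
    rw [Multiset.sum_add, Multiset.sum_add, ← hPr.sum_eq, ← hQr.sum_eq, ← two_smul ℝ,
      ← two_smul ℝ E'.sum] at this
    exact smul_right_injective V two_ne_zero this
  have s1 := congrArg Multiset.sum h1
  have s2 := congrArg Multiset.sum h2
  have s3 := congrArg Multiset.sum h3
  rw [Multiset.sum_add] at s1 s2 s3
  have hsY : (E - E').sum = (F - F').sum := add_left_cancel (s1.trans (hss.trans s3.symm))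
  have hsX : (E ∩ E').sum = (F ∩ F').sum := by
    rw [← hsY, ← hPr.sum_eq, ← s1] at s2
    exact (add_right_cancel s2).symm
  have hXE : E ∩ E' ≤ E := Multiset.inter_le_left
  have hXF : F ∩ F' ≤ F := Multiset.inter_le_left
  have hYE : E - E' ≤ E := Multiset.sub_le_self _ _
  have hYF : F - F' ≤ F := Multiset.sub_le_self _ _
  obtain ⟨X, hX, hXr⟩ := exists_isLatticePolytope_isEdgeRep c (L := span ℤ (Set.range b))
    (fun e he => hPr.pos_right e (Multiset.mem_of_le hXE he))
    (fun e he => hPr.pos_left e (Multiset.mem_of_le hXF he)) hsX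
    (fun e he => (hE e (Multiset.mem_of_le hXE he)).1)
    (fun e he => (hF e (Multiset.mem_of_le hXF he)).1)
  obtain ⟨Y, hY, hYr⟩ := exists_isLatticePolytope_isEdgeRep c (L := span ℤ (Set.range b))
    (fun e he => hPr.pos_right e (Multiset.mem_of_le hYE he))
    (fun e he => hPr.pos_left e (Multiset.mem_of_le hYF he)) hsY
    (fun e he => (hE e (Multiset.mem_of_le hYE he)).1)
    (fun e he => (hF e (Multiset.mem_of_le hYF he)).1)
  have hXY := hXr.add hYr
  rw [h1, h2] at hXY
  have hXY' := hXr.add hYr.neg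
  rw [h3, h4, ← sub_eq_add_neg] at hXY'
  have hs : (E - E').sum ∈ span ℤ (Set.range b) := sum_mem_of_le hYE fun e he => (hE e he).1
  refine ⟨X, Y, hX, hY, ⟨_, ?_, hPr.eq_vadd hXY⟩, ⟨_, ?_, hQr.eq_vadd hXY'⟩⟩
  · exact sub_mem hp (add_mem (zero_mem _) (zero_mem _))
  · exact sub_mem hq (add_mem (zero_mem _) (neg_mem (add_mem (zero_mem _) hs)))

theorem universalCounting_eq_iff (hV : finrank ℝ V = 2) (L₀ : Submodule ℤ V) (P Q : Set V) :
    universalCounting L₀ P = universalCounting L₀ Q ↔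
      ∀ D : Basis (Fin 2) ℝ V, L₀ ≤ span ℤ (Set.range D) →
        (P ∩ (span ℤ (Set.range D) : Set V)).ncard =
          (Q ∩ (span ℤ (Set.range D) : Set V)).ncard := by
  constructor
  · intro h D hD
    exact Nat.cast_injective (R := ℤ) <| congrFun h ⟨span ℤ (Set.range D), isLattice_span_basis D, hD⟩
  · intro h
    ext ⟨L, hL, hle⟩
    obtain ⟨D, rfl⟩ := hL.exists_basis hV
    exact congrArg Nat.cast (h D hle)

end Main

theorem theorem3 {V : Type*} [NormedAddCommGroup V] [NormedSpace ℝ V]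
    [MeasurableSpace V] [BorelSpace V] (hV : Module.finrank ℝ V = 2)
    (area : MeasureTheory.Measure V) [area.IsAddHaarMeasure]
    (L₀ : Submodule ℤ V) (hL₀ : IsLattice L₀)
    (P Q : Set V) (hP : IsLatticePolytope L₀ P) (hQ : IsLatticePolytope L₀ Q) :
    universalCounting L₀ P = universalCounting L₀ Q ↔
      area P = area Q ∧
      ∃ X Y : Set V, IsLatticePolytope L₀ X ∧ IsLatticePolytope L₀ Y ∧
        IsLatticeTranslate L₀ P (X + Y) ∧ IsLatticeTranslate L₀ Q (X - Y) := by
  rw [universalCounting_eq_iff hV]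
  obtain ⟨b, rfl⟩ := hL₀.exists_basis hV
  constructor
  · intro h
    have harea := measure_eq_of_ncard_eq area b hP.convex hP.isCompact hQ.convex hQ.isCompact h
    exact ⟨harea, exists_minkowski_of_ncard_eq area hP hQ h harea⟩
  · rintro ⟨harea, X, Y, hX, hY, hPX, hQX⟩
    exact ncard_eq_of_minkowski area hX hY hPX hQX harea
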